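/- **Setting.** Fix integers $d\ge 1$, $k\ge 1$, a noise level $\sigma>0$ and constants $K$, $A$, $c_{\max}$ and $a>0$. Let $n_1,\dots,n_d\ge k+1$ with $n_i\le K n_j$ for all $i,j$ (that is, $n_1\asymp\dots\asymp n_d$), and $n=n_1\cdots n_d$. We observe $Y=f^0+\epsilon\in\mathbb R^{n_1\times\dots\times n_d}$, where $f^0$ is arbitrary and $\epsilon$ has i.i.d. $\mathcal N(0,\sigma^2)$ entries. *Dictionary.* For $m\ge k+1$ let $\phi^1_j=(1_{\{t\ge j\}})_{t\in[m]}$ and, for $2\le r\le k$, $\phi^r_j=\phi^j_j$ if $j\le r-1$ and $\phi^r_j=\frac1m\sum_{l=j}^m\phi^{r-1}_l$ if $r\le j\le m$. With $\mathrm A_V$ the orthogonal projection of $\mathbb R^m$ onto $V^\perp$, put $v_j=\mathrm A_{\mathrm{span}\{\phi^l_l:\,l<j\}}\phi^j_j$ and $\tilde\phi^k_j=\sqrt m\,v_j/\|v_j\|_2$ for $j\le k$, and $\tilde\phi^k_j=\mathrm A_{\mathrm{span}\{\phi^l_l:\,l\le k\}}\phi^k_j$ for $k<j\le m$. In coordinate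 $i$ take $m=n_i$, and let $\tilde\phi^k_{j_1,\dots,j_d}=\tilde\phi^k_{j_1}\times\dots\times\tilde\phi^k_{j_d}$. *Margins.* For $M\subseteq[d]$ and $h\in[k]^{[d]\setminus M}$ let $\mathcal M(M,h)$ be the span of the $\tilde\phi^k_{j_1,\dots,j_d}$ with $j_i>k$ for $i\in M$ and $j_i=h_i$ for $i\notin M$. Let $f_{\mathcal M(M,h)}$ be the orthogonal projection of $f$ onto $\mathcal M(M,h)$, and let $\bar f_{\mathcal M(M,h)}\in\mathbb R^{\times_{i\in M}n_i}$ be the tensor with $f_{\mathcal M(M,h)}=\bar f_{\mathcal M(M,h)}\times\bigl(\times_{i\notin M}\tilde\phi^k_{h_i}\bigr)$. Put $n_M=\prod_{i\in M}n_i$. *Vitali total variation.* For $M\ne\emptyset$ let $D^k_M=\prod_{i\in M}D^k_i$, where $$(D_i^kg)(j)=n_i^{k-1}\sum_{l=0}^k(-1)^l\binom kl g(\dots,j_i-l,\dots),\qquad j_i\in[k+1:n_i].$$ The $k$-th order $|M|$-dimensional Vitali total variation of $g\in\mathbb R^{\times_{i\in M}n_i}$ is $\|D^k_Mg\|_1$.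 *Estimator.* For tuning parameters $\lambda_{M,h}>0$, let $$\hat f=\sum_{h\in[k]^d}Y_{\mathcal M(\emptyset,h)}+\sum_{M\neq\emptyset}\ \sum_{h}\ \hat{\bar f}_{\mathcal M(M,h)}\times\bigl(\times_{i\notin M}\tilde\phi^k_{h_i}\bigr),$$ $$\hat{\bar f}_{\mathcal M(M,h)}=\operatorname*{arg\,min}_{g\in\mathbb R^{\times_{i\in M}n_i}}\Bigl\{\|\bar Y_{\mathcal M(M,h)}-g\|_2^2/n_M+2\lambda_{M,h}\|D^k_Mg\|_1\Bigr\}.$$ **Theorem 6.2.** Let $H(d)=\sum_{i=1}^d 1/i$ and $$r_n=n^{-\frac{H(d)+2k-1}{2H(d)+2k-1}}\,(\log n)^{\frac{H(d)}{2H(d)+2k-1}}.$$ There are constants $C_1,C_2>0$, depending only on $d,k,\sigma,K,a,A,c_{\max}$, such that for all $n_1,\dots,n_d$ and $f^0$ as above, all $\lambda_{M,h}$ with $a\,r_n\le\lambda_{M,h}\le A\,r_n$ and all $c_{M,h}$ with $0<c_{M,h}\le c_{\max}$, with probability at least $1-C_1/n$, $$\frac{\|\hat f-f^0\|_2^2}{n}\le\sum_{\emptyset\neq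 M\subseteq[d]}\ \sum_{h\in[k]^{[d]\setminus M}}\ \min_{g\in\mathbb R^{\times_{i\in M}n_i}:\ \|D^k_Mg\|_1\le c_{M,h}}\frac{\|\bar f^0_{\mathcal M(M,h)}-g\|_2^2}{n_M}+C_2\,r_n .$$ -/

import Mathlib

open MeasureTheory ProbabilityTheory
open scoped NNReal

noncomputable section

namespace TrendFiltering

/-! Indices are zero-based: index `j` here is index `j + 1` in the usual one-based notation. -/

/-- Multi-indices `[n₁] × ⋯ × [n_d]`; the coordinates are labelled by a type `ι`. -/
abbrev Idx {ι : Type*} (n : ι → ℕ) : Type _ := ∀ i, Fin (n i)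

/-- Real tensors of shape `n`; the norm is the Frobenius norm. -/
abbrev Tensor {ι : Type*} (n : ι → ℕ) : Type _ := EuclideanSpace ℝ (Idx n)

section Differences

variable {ι : Type*} [Fintype ι] [DecidableEq ι]

/-- The total `k`-th order difference operator `D^k = ∏ᵢ Dᵢ^k`, where
`(Dᵢ^k f)(j) = nᵢ^(k-1) ∑_{l ≤ k} (-1)^l (k choose l) f(…, jᵢ - l, …)` for `jᵢ ≥ k` (zero-based).
The product of the coordinatewise operators is written out as one sum over `l = (lᵢ)ᵢ`, and
the result is extended by zero to the multi-indices with some `jᵢ < k`, where it is undefined. -/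
def totalDiff (n : ι → ℕ) (k : ℕ) (f : Tensor n) (j : Idx n) : ℝ :=
  if ∀ i, k ≤ (j i : ℕ) then
    (∏ i, (n i : ℝ) ^ (k - 1)) *
      ∑ l : ι → Fin (k + 1), (∏ i, ((-1 : ℝ) ^ (l i : ℕ) * (k.choose (l i) : ℝ))) *
        f (fun i => ⟨(j i : ℕ) - (l i : ℕ), lt_of_le_of_lt (Nat.sub_le _ _) (j i).isLt⟩)
  else 0

/-- The `k`-th order Vitali total variation `‖D^k f‖₁`. -/
def vitaliTV (n : ι → ℕ) (k : ℕ) (f : Tensor n) : ℝ :=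
  ∑ j, |totalDiff n k f j|

/-- The trend filtering objective `‖y - f‖₂² / (∏ᵢ nᵢ) + 2 lam TV_k(f)`. -/
def tfObjective (n : ι → ℕ) (k : ℕ) (lam : ℝ) (y f : Tensor n) : ℝ :=
  ‖y - f‖ ^ 2 / ((∏ i, n i : ℕ) : ℝ) + 2 * lam * vitaliTV n k f

end Differences

section Dictionary

/-- The dictionary vectors of order `k ≥ 1` in `ℝ^m` (truncated monomials of degree `k - 1`):
`phi m 1 j = 1_{· ≥ j}`, and for `k ≥ 2` the vector `phi m k j` is `∑_{l ≥ j} phi m (k-1) l / m`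
if `k - 1 ≤ j` and `phi m (j + 1) j` if `j < k - 1` (see `phi_of_lt`).
The value at `k = 0` is not used. -/
def phi (m : ℕ) : ℕ → ℕ → EuclideanSpace ℝ (Fin m)
  | 0, _ => 0
  | 1, j => WithLp.toLp 2 fun t => if j ≤ (t : ℕ) then 1 else 0
  | k + 2, j =>
      if j < k + 1 then phi m (k + 1) j
      else ∑ l ∈ Finset.Ico j m, (m : ℝ)⁻¹ • phi m (k + 1) l

theorem phi_of_lt (m k j : ℕ) (h : j < k) : phi m k j = phi m (j + 1) j := by
  induction k with
  | zero => omega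
  | succ k ih =>
    rcases Nat.lt_succ_iff_lt_or_eq.mp h with h' | rfl
    · obtain ⟨k, rfl⟩ : ∃ r, k = r + 1 := ⟨k - 1, by omega⟩
      rw [phi, if_pos h']
      exact ih h'
    · rfl

/-- `span {φ^{l+1}_l : l < r}`, the vectors given by polynomials of degree `< r`. -/
def polySpan (m r : ℕ) : Submodule ℝ (EuclideanSpace ℝ (Fin m)) :=
  Submodule.span ℝ ((fun l => phi m (l + 1) l) '' Set.Iio r)

/-- The partially orthonormalized dictionary of order `k` in `ℝ^m`: for `j < k` it is the
component of `φ^{j+1}_j` orthogonal to `{φ^{l+1}_l : l < j}`, rescaled to have norm `√m`; for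
`k ≤ j` it is the component of `φ^k_j` orthogonal to `{φ^{l+1}_l : l < k}`. -/
def dict (m k j : ℕ) : EuclideanSpace ℝ (Fin m) :=
  if j < k then
    (√(m : ℝ) / ‖(polySpan m j)ᗮ.starProjection (phi m (j + 1) j)‖) •
      (polySpan m j)ᗮ.starProjection (phi m (j + 1) j)
  else (polySpan m k)ᗮ.starProjection (phi m k j)

end Dictionary

section Margins

variable {ι : Type*} [Fintype ι] [DecidableEq ι]

/-- The dictionary tensor `⨂ᵢ dict (n i) k (κ i)`. -/
def atom (n : ι → ℕ) (k : ℕ) (κ : Idx n) : Tensor n :=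
  WithLp.toLp 2 fun j => ∏ i, dict (n i) k (κ i) (j i)

/-- The labels `h ∈ [k]^{d - |M|}` of the margins belonging to the coordinate set `M`. -/
abbrev Label (k : ℕ) (M : Finset ι) : Type _ := {i // i ∉ M} → Fin k

/-- The shape `(nᵢ)_{i ∈ M}`. -/
abbrev subShape (n : ι → ℕ) (M : Finset ι) : {i // i ∈ M} → ℕ := fun i => n i

/-- The marginal linear space `𝓜(M, h)`. -/
def marginSpace (n : ι → ℕ) (k : ℕ) (M : Finset ι) (h : Label k M) : Submodule ℝ (Tensor n) :=
  Submodule.span ℝ (atom n k ''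
    {κ | (∀ i ∈ M, k ≤ (κ i : ℕ)) ∧ ∀ i : {i // i ∉ M}, (κ i : ℕ) = (h i : ℕ)})

/-- The component `f_{𝓜(M, h)}` of `f` in the ANOVA decomposition. -/
def margin (n : ι → ℕ) (k : ℕ) (M : Finset ι) (h : Label k M) (f : Tensor n) : Tensor n :=
  (marginSpace n k M h).starProjection f

/-- The tensor `g × ⨂_{i ∉ M} dict (n i) k (h i)` for a tensor `g` indexed by `M` only. -/
def embed (n : ι → ℕ) (k : ℕ) (M : Finset ι) (h : Label k M) (g : Tensor (subShape n M)) : Tensor n :=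
  WithLp.toLp 2 fun j => g (fun i => j i) * ∏ i : {i // i ∉ M}, dict (n i) k (h i) (j i)

/-- The multi-index with coordinates `a` on `M` and `b` off `M`. -/
def glue {n : ι → ℕ} {M : Finset ι} (a : Idx (subShape n M)) (b : ∀ i : {i // i ∉ M}, Fin (n i)) :
    Idx n :=
  fun i => if hi : i ∈ M then a ⟨i, hi⟩ else b ⟨i, hi⟩

/-- The `|M|`-dimensional tensor `f̄_{𝓜(M, h)}` with
`f_{𝓜(M, h)} = f̄_{𝓜(M, h)} × ⨂_{i ∉ M} dict (n i) k (h i)`; see `embed_marginCoef`. -/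
def marginCoef (n : ι → ℕ) (k : ℕ) (M : Finset ι) (h : Label k M) (f : Tensor n) :
    Tensor (subShape n M) :=
  WithLp.toLp 2 fun a => ((∏ i : {i // i ∉ M}, n i : ℕ) : ℝ)⁻¹ *
    ∑ b : ∀ i : {i // i ∉ M}, Fin (n i),
      margin n k M h f (glue a b) * ∏ i : {i // i ∉ M}, dict (n i) k (h i) (b i)

/-- `fhat` is the whole-tensor estimator for the data `y` and the tuning parameters `lam`: the
sum of all the estimated margins, where the `0`-dimensional margins are estimated by least
squares, and the margin `(M, h)` with `M ≠ ∅` by `|M|`-dimensional trend filtering. -/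
def IsWholeEstimator (n : ι → ℕ) (k : ℕ) (lam : ∀ M : Finset ι, Label k M → ℝ)
    (y fhat : Tensor n) : Prop :=
  ∃ g : ∀ M : Finset ι, Label k M → Tensor (subShape n M),
    (∀ h, g ∅ h = marginCoef n k ∅ h y) ∧
    (∀ M : Finset ι, M.Nonempty → ∀ h : Label k M,
      IsMinOn (tfObjective (subShape n M) k (lam M h) (marginCoef n k M h y)) Set.univ (g M h)) ∧
    fhat = ∑ M : Finset ι, ∑ h : Label k M, embed n k M h (g M h)

/-- `min {‖f̄_{𝓜(M, h)} - g‖₂² / n_M : TV_k(g) ≤ c}` with `n_M = ∏_{i ∈ M} nᵢ`. -/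
def approxError (n : ι → ℕ) (k : ℕ) (M : Finset ι) (h : Label k M) (c : ℝ) (f : Tensor n) : ℝ :=
  ⨅ g : {g : Tensor (subShape n M) // vitaliTV (subShape n M) k g ≤ c},
    ‖marginCoef n k M h f - g‖ ^ 2 / ((∏ i : {i // i ∈ M}, n i : ℕ) : ℝ)

end Margins

/-- `n^{-(H(d)+2k-1)/(2H(d)+2k-1)} (log n)^{H(d)/(2H(d)+2k-1)}`, with `H(d) = ∑_{i=1}^d 1/i`. -/
def rate (d k n : ℕ) : ℝ :=
  (n : ℝ) ^ (-(((harmonic d : ℚ) : ℝ) + 2 * k - 1) / (2 * ((harmonic d : ℚ) : ℝ) + 2 * k - 1)) *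
    Real.log n ^ (((harmonic d : ℚ) : ℝ) / (2 * ((harmonic d : ℚ) : ℝ) + 2 * k - 1))

section Facts

theorem phi_succ_apply (m k : ℕ) :
    (∀ (j : ℕ) (t : Fin m), (t : ℕ) < j → phi m (k + 1) j t = 0) ∧
      ∀ t : Fin m, 0 < phi m (k + 1) t t := by
  induction k with
  | zero =>
    refine ⟨fun j t h => ?_, fun t => ?_⟩
    · simp [phi, h]
    · simp [phi]
  | succ k ih =>
    refine ⟨fun j t h => ?_, fun t => ?_⟩
    · rw [phi]
      split_ifs
      · exact ih.1 j t h
      · rw [WithLp.ofLp_sum, Finset.sum_apply]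
        refine Finset.sum_eq_zero fun l hl => ?_
        have := (Finset.mem_Ico.mp hl).1
        simp [ih.1 l t (by omega)]
    · rw [phi]
      split_ifs
      · exact ih.2 t
      · have hm : 0 < m := t.pos
        rw [WithLp.ofLp_sum, Finset.sum_apply, Finset.sum_eq_single (t : ℕ)]
        · have := ih.2 t
          simp only [PiLp.smul_apply, smul_eq_mul]
          positivity
        · intro l hl hne
          have := (Finset.mem_Ico.mp hl).1
          simp [ih.1 l t (by omega)]
        · intro h
          exact absurd (Finset.mem_Ico.mpr ⟨le_rfl, t.isLt⟩) h

theorem eq_zero_of_mem_polySpan (m r : ℕ) (hr : r ≤ m) (v : EuclideanSpace ℝ (Fin m))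
    (hv : v ∈ polySpan m r) (h0 : ∀ t : Fin m, (t : ℕ) < r → v t = 0) : v = 0 := by
  induction r generalizing v with
  | zero => simpa [polySpan] using hv
  | succ r ih =>
    have hset : Set.Iio (r + 1) = insert r (Set.Iio r) := by
      ext x; simp only [Set.mem_Iio, Set.mem_insert_iff]; omega
    rw [polySpan, hset, Set.image_insert_eq, Submodule.mem_span_insert] at hv
    obtain ⟨c, w, hw, rfl⟩ := hv
    have hw0 : w = 0 := by
      refine ih (by omega) w hw fun t ht => ?_
      have := h0 t (by omega)
      simpa [(phi_succ_apply m r).1 r t ht] using this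
    subst hw0
    have h1 := h0 ⟨r, by omega⟩ (by simp)
    have h2 := (phi_succ_apply m r).2 ⟨r, by omega⟩
    simp only [add_zero, PiLp.smul_apply, smul_eq_mul, mul_eq_zero] at h1
    rcases h1 with rfl | h1
    · simp
    · exact absurd h1 h2.ne'

theorem norm_dict (m k j : ℕ) (hj : j < k) (hm : j < m) : ‖dict m k j‖ = √(m : ℝ) := by
  have hne : ‖(polySpan m j)ᗮ.starProjection (phi m (j + 1) j)‖ ≠ 0 := by
    rw [norm_ne_zero_iff]
    intro h
    have hmem : phi m (j + 1) j ∈ polySpan m j := by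
      rw [Submodule.starProjection_orthogonal_val, sub_eq_zero] at h
      exact Submodule.starProjection_eq_self_iff.mp h.symm
    have := eq_zero_of_mem_polySpan m j hm.le _ hmem ((phi_succ_apply m j).1 j)
    have h2 := (phi_succ_apply m j).2 ⟨j, hm⟩
    simp [this] at h2
  rw [dict, if_pos hj, norm_smul, Real.norm_eq_abs, abs_of_nonneg (by positivity)]
  field_simp

variable {ι : Type*} [Fintype ι] [DecidableEq ι]

theorem exists_embed_eq (n : ι → ℕ) (k : ℕ) (M : Finset ι) (h : Label k M) (p : Tensor n)
    (hp : p ∈ marginSpace n k M h) : ∃ g, p = embed n k M h g := by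
  induction hp using Submodule.span_induction with
  | mem x hx =>
    obtain ⟨κ, ⟨-, hκ⟩, rfl⟩ := hx
    refine ⟨WithLp.toLp 2 fun a => ∏ i : {i // i ∈ M}, dict (n i) k (κ i) (a i), ?_⟩
    ext j
    simp only [atom, embed]
    rw [← Fintype.prod_subtype_mul_prod_subtype (fun i => i ∈ M)]
    congr 1
    · exact Finset.prod_congr (by ext; simp) fun _ _ => rfl
    · exact Finset.prod_congr rfl fun i _ => by rw [hκ i]
  | zero => exact ⟨0, by ext j; simp [embed]⟩
  | add x y _ _ hx hy =>
    obtain ⟨g, rfl⟩ := hx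
    obtain ⟨g', rfl⟩ := hy
    exact ⟨g + g', by ext j; simp [embed, add_mul]⟩
  | smul a x _ hx =>
    obtain ⟨g, rfl⟩ := hx
    exact ⟨a • g, by ext j; simp [embed, mul_assoc]⟩

/-- The defining property of `marginCoef`. -/
theorem embed_marginCoef (n : ι → ℕ) (k : ℕ) (hn : ∀ i, k ≤ n i) (M : Finset ι)
    (h : Label k M) (f : Tensor n) :
    embed n k M h (marginCoef n k M h f) = margin n k M h f := by
  obtain ⟨g, hg⟩ := exists_embed_eq n k M h (margin n k M h f)
    (Submodule.starProjection_apply_mem _ _)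
  suffices hc : marginCoef n k M h f = g by rw [hc, hg]
  have hsq : ∀ i : {i // i ∉ M}, ∑ t, dict (n i) k (h i) t ^ 2 = (n i : ℝ) := by
    intro i
    have := norm_dict (n i) k (h i) (h i).isLt (lt_of_lt_of_le (h i).isLt (hn i))
    have h2 := EuclideanSpace.real_norm_sq_eq (dict (n i) k (h i))
    rw [← h2, this, Real.sq_sqrt (by positivity)]
  have hpos : (∏ i : {i // i ∉ M}, (n i : ℝ)) ≠ 0 := by
    refine Finset.prod_ne_zero_iff.mpr fun i _ => ?_
    have := lt_of_lt_of_le (h i).pos (hn i)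
    positivity
  ext a
  simp only [marginCoef, hg, embed]
  have hin : ∀ b : (∀ i : {i // i ∉ M}, Fin (n i)),
      (g (fun i : {i // i ∈ M} => glue a b i) *
        ∏ i : {i // i ∉ M}, dict (n i) k (h i) (glue a b i)) *
        ∏ i : {i // i ∉ M}, dict (n i) k (h i) (b i) =
      g a * ∏ i : {i // i ∉ M}, dict (n i) k (h i) (b i) ^ 2 := by
    intro b
    have e1 : (fun i : {i // i ∈ M} => glue a b i) = a := by
      funext i; simp [glue, i.2]
    have e2 : ∀ i : {i // i ∉ M}, glue a b i = b i := by
      intro i; simp [glue, i.2]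
    simp only [e2, Finset.prod_pow]
    rw [e1]
    ring
  rw [Finset.sum_congr rfl fun b _ => hin b, ← Finset.mul_sum,
    ← Fintype.prod_sum (fun (i : {i // i ∉ M}) t => dict (n i) k (h i) t ^ 2)]
  simp only [hsq]
  push_cast
  field_simp

end Facts

end TrendFiltering

end

open TrendFiltering

/-! The dictionary is dual to the difference operator: modulo polynomials of degree below `k`, a
vector is the combination of the truncated monomials whose coefficients are its `k`-th differences.
Tensorised, the orthogonal projection of `w` onto the span of the penalised atoms is the sum of
`totalDiff w a • atom a` (`inner_rowPart`). Hence noise tested against `w` is at most the largest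
|⟨atom, noise⟩| times the Vitali variation of `w`.

Used directly, this would force tuning parameters of order √(log n / n). The faster rate comes from
a subspace `V` of dimension of order `s`. The noise inside `V` is paid for by its dimension, through
a chi-square bound, and only the residuals of the atoms off `V` are charged to the penalty
(`two_mul_inner_le`, `margin_oracle`). The oracle inequality itself is the variational inequality
for a convex penalised problem; the variation of the estimator cancels, leaving that of the
competitor.

It remains to find `V` (`exists_approx_space`). In one coordinate a truncated monomial is
approximated by piecewise polynomials on `2^l` blocks with relative error 2^(-l(2k-1)/2), since only
the block containing the knot contributes (`exists_multiscale`). Outer products over the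
multi-scales of bounded total scale give dimension of order `s` and relative error
s^(-(2k-1)/(2H(d))) (`exists_scales`). For `d = 1` this is a plain cutoff. For `d ≥ 2` one has H(d)
≥ 3/2, and the resulting slack in the exponent absorbs the multiplicity of scales of equal sum.
Equating √(n log n) s^(-(2k-1)/(2H(d))) with `s` gives s = n r_n (`sqrt_mul_log_mul_rpow`).

The margins are mutually orthogonal and exhaust the space, and each estimated margin stays in its
own space, so squared errors add (`norm_estimator_sub_sq`). One union bound controls all atoms and
all projections (`noise_control`). -/

set_option linter.unusedSectionVars false

/-! ### Deviation bounds for Gaussian vectors. -/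

section GaussianConcentration

variable {E : Type*} [NormedAddCommGroup E] [InnerProductSpace ℝ E] [FiniteDimensional ℝ E]
  [MeasurableSpace E] [BorelSpace E]

theorem integrable_gaussianPDFReal_smul_exp_sq :
    Integrable (fun x : ℝ => gaussianPDFReal 0 1 x • Real.exp (x ^ 2 / 4)) := by
  have h := (integrable_exp_neg_mul_sq (b := 1 / 4) (by norm_num)).const_mul
    (√(2 * Real.pi))⁻¹
  refine h.congr (Filter.Eventually.of_forall fun x => ?_)
  simp only [gaussianPDFReal, smul_eq_mul, NNReal.coe_one, sub_zero, mul_one, mul_assoc,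
    ← Real.exp_add]
  ring_nf

theorem integrable_exp_sq_gaussianReal :
    Integrable (fun x : ℝ => Real.exp (x ^ 2 / 4)) (gaussianReal 0 1) := by
  rw [gaussianReal, if_neg one_ne_zero,
    integrable_withDensity_iff_integrable_smul' (measurable_gaussianPDF _ _)
      (ae_of_all _ fun _ => gaussianPDF_lt_top)]
  simpa only [toReal_gaussianPDF] using integrable_gaussianPDFReal_smul_exp_sq

/-- The exponent 1/4 is a convenient value below the integrability threshold 1/2: the resulting
constant √2 is at most exp(1/2). -/
theorem integral_exp_sq_gaussianReal :
    ∫ x : ℝ, Real.exp (x ^ 2 / 4) ∂(gaussianReal 0 1) = √2 := by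
  rw [integral_gaussianReal_eq_integral_smul one_ne_zero]
  have h : ∀ x : ℝ, gaussianPDFReal 0 1 x • Real.exp (x ^ 2 / 4) =
      (√(2 * Real.pi))⁻¹ * Real.exp (-(1 / 4) * x ^ 2) := by
    intro x
    simp only [gaussianPDFReal, smul_eq_mul, NNReal.coe_one, sub_zero, mul_one, mul_assoc,
      ← Real.exp_add]
    ring_nf
  simp_rw [h]
  rw [integral_const_mul, integral_gaussian, ← Real.sqrt_inv, ← Real.sqrt_mul (by positivity)]
  congr 1
  field_simp
  norm_num

theorem norm_sq_sum_smul_orthonormalBasis {ι F : Type*} [Fintype ι] [NormedAddCommGroup F]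
    [InnerProductSpace ℝ F] (b : OrthonormalBasis ι ℝ F) (x : ι → ℝ) :
    ‖∑ i, x i • b i‖ ^ 2 = ∑ i, x i ^ 2 := by
  classical
  rw [← b.sum_sq_inner_right]
  refine Finset.sum_congr rfl fun i _ => ?_
  rw [b.orthonormal.inner_right_fintype]

theorem integrable_exp_norm_sq_stdGaussian :
    Integrable (fun x : E => Real.exp (‖x‖ ^ 2 / 4)) (stdGaussian E) := by
  rw [stdGaussian, integrable_map_measure (Measurable.aestronglyMeasurable (by fun_prop))
    (Measurable.aemeasurable (by fun_prop))]
  refine (Integrable.fintype_prod (f := fun _ x => Real.exp (x ^ 2 / 4))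
    fun _ => integrable_exp_sq_gaussianReal).congr (Filter.Eventually.of_forall fun x => ?_)
  simp only [Function.comp, norm_sq_sum_smul_orthonormalBasis, ← Real.exp_sum, Finset.sum_div]

theorem integral_exp_norm_sq_stdGaussian :
    ∫ x : E, Real.exp (‖x‖ ^ 2 / 4) ∂(stdGaussian E) = √2 ^ Module.finrank ℝ E := by
  rw [stdGaussian, integral_map (Measurable.aemeasurable (by fun_prop))
    (Measurable.aestronglyMeasurable (by fun_prop))]
  simp only [norm_sq_sum_smul_orthonormalBasis, Finset.sum_div, Real.exp_sum]
  rw [integral_fintype_prod_eq_prod (f := fun _ (x : ℝ) => Real.exp (x ^ 2 / 4))]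
  simp [integral_exp_sq_gaussianReal]

/-- Characteristic functions agree, because testing a projection against an element of `V` is
testing the vector itself. -/
theorem stdGaussian_map_orthogonalProjection (V : Submodule ℝ E) :
    (stdGaussian E).map V.orthogonalProjectionOnto = stdGaussian V := by
  apply Measure.ext_of_charFun
  ext t
  have h := charFun_stdGaussian (t : E)
  rw [charFun_stdGaussian, charFun_apply, integral_map (by fun_prop) (by fun_prop)]
  rw [charFun_apply] at h
  have h2 : ∀ x : E, inner ℝ (V.orthogonalProjectionOnto x) t = inner ℝ x (t : E) := by
    intro x
    simp
  simp only [h2, h, Submodule.coe_norm]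

/-- Chi-square deviation bound for the projection of a standard Gaussian vector. -/
theorem stdGaussian_norm_projection_le (V : Submodule ℝ E) (x : ℝ) :
    (stdGaussian E).real {z | 2 * Module.finrank ℝ V + 4 * x ≤ ‖V.starProjection z‖ ^ 2} ≤
      Real.exp (-x) := by
  have hset : {z : E | 2 * Module.finrank ℝ V + 4 * x ≤ ‖V.starProjection z‖ ^ 2} =
      V.orthogonalProjectionOnto ⁻¹' {z : V | 2 * Module.finrank ℝ V + 4 * x ≤ ‖z‖ ^ 2} := by
    ext z
    rw [Set.mem_preimage, Set.mem_ofPred_eq, Set.mem_ofPred_eq, Submodule.starProjection_apply,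
      Submodule.coe_norm]
  rw [hset, ← map_measureReal_apply (by fun_prop)
    (measurableSet_le (by fun_prop) (by fun_prop)), stdGaussian_map_orthogonalProjection]
  -- Markov's inequality for exp(‖z‖²/4) at level exp(dim/2 + x).
  have hm := mul_meas_ge_le_integral_of_nonneg
    (Filter.Eventually.of_forall fun z : V => (Real.exp_pos (‖z‖ ^ 2 / 4)).le)
    integrable_exp_norm_sq_stdGaussian (Real.exp (Module.finrank ℝ V / 2 + x))
  rw [integral_exp_norm_sq_stdGaussian] at hm
  have hsub : {z : V | 2 * Module.finrank ℝ V + 4 * x ≤ ‖z‖ ^ 2} ⊆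
      {z : V | Real.exp (Module.finrank ℝ V / 2 + x) ≤ Real.exp (‖z‖ ^ 2 / 4)} := by
    intro z hz
    simp only [Set.mem_ofPred_eq, Real.exp_le_exp] at hz ⊢
    linarith
  -- Since 2 ≤ e, the moment is at most exp(dim/2); this cancels the dimensional part of the level
  -- and leaves exp(-x).
  have h2 : √2 ^ Module.finrank ℝ V ≤ Real.exp (Module.finrank ℝ V / 2 : ℝ) := by
    have : √2 ≤ Real.exp (1 / 2) := by
      rw [show Real.exp (1 / 2 : ℝ) = √(Real.exp 1) by
        rw [Real.sqrt_eq_rpow, ← Real.exp_mul]; norm_num]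
      exact Real.sqrt_le_sqrt (by linarith [Real.add_one_le_exp 1])
    calc √2 ^ Module.finrank ℝ V ≤ Real.exp (1 / 2) ^ Module.finrank ℝ V := by gcongr
      _ = _ := by rw [← Real.exp_nat_mul]; ring_nf
  have h3 := (measureReal_mono hsub (measure_ne_top (stdGaussian V) _))
  rw [Real.exp_add] at hm
  have h4 : Real.exp x * (stdGaussian V).real
      {z : V | Real.exp (Module.finrank ℝ V / 2 + x) ≤ Real.exp (‖z‖ ^ 2 / 4)} ≤ 1 := by
    rw [Real.exp_add]
    refine le_of_mul_le_mul_left ?_ (Real.exp_pos (Module.finrank ℝ V / 2 : ℝ))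
    rw [← mul_assoc, mul_one]
    exact hm.trans h2
  rw [Real.exp_neg]
  exact h3.trans ((le_inv_mul_iff₀ (Real.exp_pos x)).mpr h4 |>.trans_eq (mul_one _))

/-- Chernoff's bound with exponential parameter equal to the level `t`, the optimal choice when `u`
has norm one. -/
theorem stdGaussian_inner_le (u : E) (hu : ‖u‖ ≤ 1) (t : ℝ) (ht : 0 ≤ t) :
    (stdGaussian E).real {z | t ≤ inner ℝ u z} ≤ Real.exp (-t ^ 2 / 2) := by
  have hmap := IsGaussian.map_eq_gaussianReal (μ := stdGaussian E) (innerSL ℝ u)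
  rw [integral_strongDual_stdGaussian, variance_dual_stdGaussian, innerSL_apply_norm] at hmap
  have hmgf := mgf_gaussianReal hmap t
  have hint : Integrable (fun z : E => Real.exp (t * innerSL ℝ u z)) (stdGaussian E) := by
    rw [← mgf_pos_iff, hmgf]
    exact Real.exp_pos _
  have h := measure_ge_le_exp_mul_mgf t ht hint
  rw [hmgf, ← Real.exp_add] at h
  simp only [innerSL_apply_apply] at h
  refine h.trans (Real.exp_le_exp.mpr ?_)
  have hu2 : ‖u‖ ^ 2 ≤ 1 := pow_le_one₀ (norm_nonneg _) hu
  rw [Real.coe_toNNReal _ (by positivity)]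
  nlinarith [mul_nonneg (sub_nonneg.mpr hu2) (sq_nonneg t)]

theorem stdGaussian_abs_inner_le (u : E) (hu : ‖u‖ ≤ 1) (t : ℝ) (ht : 0 ≤ t) :
    (stdGaussian E).real {z | t ≤ |inner ℝ u z|} ≤ 2 * Real.exp (-t ^ 2 / 2) := by
  have hsub : {z : E | t ≤ |inner ℝ u z|} ⊆ {z | t ≤ inner ℝ u z} ∪ {z | t ≤ inner ℝ (-u) z} := by
    intro z hz
    simpa [le_abs] using hz
  have h := measureReal_mono hsub (measure_ne_top (stdGaussian E) _)
  have h2 := measureReal_union_le (μ := stdGaussian E) {z | t ≤ inner ℝ u z}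
    {z | t ≤ inner ℝ (-u) z}
  linarith [stdGaussian_inner_le u hu t ht, stdGaussian_inner_le (-u) (by simpa using hu) t ht]

/-- Simultaneous control of finitely many linear functionals and projections of a standard
Gaussian vector. -/
theorem stdGaussian_event {A B : Type*} [Fintype A] [Fintype B] (u : A → E)
    (hu : ∀ a, ‖u a‖ ≤ 1) (V : B → Submodule ℝ E) (t x : ℝ) (ht : 0 ≤ t) :
    1 - (Fintype.card A * (2 * Real.exp (-t ^ 2 / 2)) + Fintype.card B * Real.exp (-x)) ≤
      (stdGaussian E).real {z | (∀ a, |inner ℝ (u a) z| ≤ t) ∧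
        ∀ b, ‖(V b).starProjection z‖ ^ 2 ≤ 2 * Module.finrank ℝ (V b) + 4 * x} := by
  set S := {z : E | (∀ a, |inner ℝ (u a) z| ≤ t) ∧
        ∀ b, ‖(V b).starProjection z‖ ^ 2 ≤ 2 * Module.finrank ℝ (V b) + 4 * x}
  have hcover : Set.univ ⊆ S ∪ ((⋃ a, {z | t ≤ |inner ℝ (u a) z|}) ∪
      ⋃ b, {z | 2 * Module.finrank ℝ (V b) + 4 * x ≤ ‖(V b).starProjection z‖ ^ 2}) := by
    intro z _
    by_contra hz
    simp only [Set.mem_union, Set.mem_iUnion, Set.mem_ofPred_eq, not_or, not_exists, not_le] at hz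
    exact hz.1 ⟨fun a => (hz.2.1 a).le, fun b => (hz.2.2 b).le⟩
  have h0 := measureReal_mono hcover (measure_ne_top (stdGaussian E) _)
  have h1 := measureReal_union_le (μ := stdGaussian E) S
    ((⋃ a, {z | t ≤ |inner ℝ (u a) z|}) ∪
      ⋃ b, {z | 2 * Module.finrank ℝ (V b) + 4 * x ≤ ‖(V b).starProjection z‖ ^ 2})
  have h2 := measureReal_union_le (μ := stdGaussian E) (⋃ a, {z | t ≤ |inner ℝ (u a) z|})
      (⋃ b, {z | 2 * Module.finrank ℝ (V b) + 4 * x ≤ ‖(V b).starProjection z‖ ^ 2})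
  have h3 := measureReal_iUnion_fintype_le (μ := stdGaussian E)
    (fun a => {z | t ≤ |inner ℝ (u a) z|})
  have h4 := measureReal_iUnion_fintype_le (μ := stdGaussian E)
    (fun b => {z | 2 * Module.finrank ℝ (V b) + 4 * x ≤ ‖(V b).starProjection z‖ ^ 2})
  have h5 := Finset.sum_le_sum fun a (_ : a ∈ Finset.univ) =>
    stdGaussian_abs_inner_le (u a) (hu a) t ht
  have h6 := Finset.sum_le_sum fun b (_ : b ∈ Finset.univ) =>
    stdGaussian_norm_projection_le (V b) x
  rw [probReal_univ] at h0
  simp only [Finset.sum_const, Finset.card_univ, nsmul_eq_mul] at h5 h6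
  linarith

/-- Simultaneous control of finitely many linear functionals and projections of a vector of
i.i.d. centred Gaussian variables. -/
theorem iid_gaussian_event {ι Ω A B : Type*} [Fintype ι] [MeasurableSpace Ω] {P : Measure Ω}
    [IsProbabilityMeasure P] [Fintype A] [Fintype B] {σ : ℝ≥0} (hσ : 0 < σ) (ε : ι → Ω → ℝ)
    (hind : iIndepFun ε P) (hlaw : ∀ j, HasLaw (ε j) (gaussianReal 0 (σ ^ 2)) P)
    (u : A → EuclideanSpace ℝ ι) (hu : ∀ a, ‖u a‖ ≤ 1)
    (V : B → Submodule ℝ (EuclideanSpace ℝ ι)) (t x : ℝ) (ht : 0 ≤ t) :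
    1 - (Fintype.card A * (2 * Real.exp (-t ^ 2 / 2)) + Fintype.card B * Real.exp (-x)) ≤
      P.real {ω | (∀ a, |inner ℝ (u a) (WithLp.toLp 2 fun j => ε j ω)| ≤ σ * t) ∧
        ∀ b, ‖(V b).starProjection (WithLp.toLp 2 fun j => ε j ω)‖ ^ 2 ≤
          σ ^ 2 * (2 * Module.finrank ℝ (V b) + 4 * x)} := by
  have hσ' : (0 : ℝ) < σ := hσ
  have hm : ∀ j, AEMeasurable (ε j) P := fun j => (hlaw j).aemeasurable
  have hlaw' : ∀ j, P.map (fun ω => (σ : ℝ)⁻¹ * ε j ω) = gaussianReal 0 1 := by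
    intro j
    rw [show (fun ω => (σ : ℝ)⁻¹ * ε j ω) = (fun y : ℝ => (σ : ℝ)⁻¹ * y) ∘ ε j from rfl,
      ← AEMeasurable.map_map_of_aemeasurable (by fun_prop) (hm j), (hlaw j).map_eq,
      gaussianReal_map_const_mul, mul_zero]
    congr 1
    ext
    simp [hσ'.ne']
  have hind' : iIndepFun (fun j ω => (σ : ℝ)⁻¹ * ε j ω) P :=
    hind.comp (fun _ y => (σ : ℝ)⁻¹ * y) fun _ => by fun_prop
  have hpi : P.map (fun ω j => (σ : ℝ)⁻¹ * ε j ω) = Measure.pi fun _ => gaussianReal 0 1 := by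
    rw [hind'.map_fun_eq_pi_map fun j => (hm j).const_mul _]
    simp only [hlaw']
  -- Independence and the marginal laws identify the rescaled noise vector as standard Gaussian, so
  -- the estimates transfer to an arbitrary probability space.
  have hvec : P.map (fun ω => (WithLp.toLp 2 fun j => (σ : ℝ)⁻¹ * ε j ω : EuclideanSpace ℝ ι)) =
      stdGaussian (EuclideanSpace ℝ ι) := by
    rw [← map_pi_eq_stdGaussian, ← hpi, AEMeasurable.map_map_of_aemeasurable (by fun_prop)
      (aemeasurable_pi_lambda _ fun j => (hm j).const_mul _)]
    rfl
  have hae : AEMeasurable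
      (fun ω => (WithLp.toLp 2 fun j => (σ : ℝ)⁻¹ * ε j ω : EuclideanSpace ℝ ι)) P :=
    (by fun_prop : Measurable (WithLp.toLp 2 : (ι → ℝ) → EuclideanSpace ℝ ι)).comp_aemeasurable
      (aemeasurable_pi_lambda _ fun j => (hm j).const_mul _)
  refine (stdGaussian_event u hu V t x ht).trans ?_
  rw [← hvec, map_measureReal_apply_of_aemeasurable hae]
  · refine measureReal_mono (fun ω hω => ?_) (measure_ne_top _ _)
    have hs : (WithLp.toLp 2 fun j => ε j ω : EuclideanSpace ℝ ι) =
        (σ : ℝ) • WithLp.toLp 2 fun j => (σ : ℝ)⁻¹ * ε j ω := by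
      ext j
      simp [hσ'.ne']
    simp only [Set.mem_preimage, Set.mem_ofPred_eq] at hω ⊢
    rw [hs]
    refine ⟨fun a => ?_, fun b => ?_⟩
    · rw [inner_smul_right, abs_mul, abs_of_pos hσ']
      exact mul_le_mul_of_nonneg_left (hω.1 a) hσ'.le
    · rw [map_smul, norm_smul, mul_pow, Real.norm_eq_abs, sq_abs]
      exact mul_le_mul_of_nonneg_left (hω.2 b) (by positivity)
  · simp only [Set.ofPred_and, Set.ofPred_forall]
    refine (MeasurableSet.iInter fun a => measurableSet_le (by fun_prop) (by fun_prop)).inter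
      (MeasurableSet.iInter fun b => measurableSet_le (by fun_prop) (by fun_prop))

end GaussianConcentration

noncomputable section

namespace TrendFiltering

/-! ### The one-dimensional dictionary and its duality with differences. -/

section OneDimensional

/-- The truncated binomial `t ↦ (t - j + r choose r) 1_{t ≥ j}`. -/
def truncBinom (r j t : ℕ) : ℝ := if j ≤ t then ((t - j + r).choose r : ℝ) else 0

/-- Each cumulative sum raises the lower binomial index by the hockey-stick identity. The condition
`r ≤ j` keeps every step of the recursion in its summing branch. -/
theorem phi_eq_truncBinom (m r j : ℕ) (hr : r ≤ j) (t : Fin m) :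
    phi m (r + 1) j t = ((m : ℝ) ^ r)⁻¹ * truncBinom r j t := by
  induction r generalizing j with
  | zero => simp [phi, truncBinom]
  | succ r ih =>
    rw [phi, if_neg (by omega), WithLp.ofLp_sum, Finset.sum_apply]
    have h1 : ∀ l ∈ Finset.Ico j m, ((m : ℝ)⁻¹ • phi m (r + 1) l) t =
        ((m : ℝ) ^ (r + 1))⁻¹ * truncBinom r l t := by
      intro l hl
      rw [Finset.mem_Ico] at hl
      rw [PiLp.smul_apply, ih l (by omega), smul_eq_mul, pow_succ, mul_inv]
      ring
    rw [Finset.sum_congr rfl h1, ← Finset.mul_sum]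
    congr 1
    unfold truncBinom
    split_ifs with hjt
    · have ht := t.isLt
      rw [← Finset.sum_filter]
      have h2 : (Finset.Ico j m).filter (fun l => l ≤ (t : ℕ)) = Finset.Ico j (t + 1) := by
        ext l
        simp only [Finset.mem_filter, Finset.mem_Ico]
        omega
      rw [h2, Finset.sum_Ico_eq_sum_range, ← Finset.sum_range_reflect]
      have h3 : ∀ i ∈ Finset.range ((t : ℕ) + 1 - j),
          (((t : ℕ) - (j + ((t : ℕ) + 1 - j - 1 - i)) + r).choose r : ℝ) =
            ((i + r).choose r : ℝ) := by
        intro i hi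
        rw [Finset.mem_range] at hi
        congr 2
        omega
      rw [Finset.sum_congr rfl h3, show (t : ℕ) + 1 - j = (t - j) + 1 by omega]
      exact_mod_cast Nat.sum_range_add_choose ((t : ℕ) - j) r
    · refine Finset.sum_eq_zero fun l hl => ?_
      rw [Finset.mem_Ico] at hl
      rw [if_neg (by omega)]

/-- Pascal's rule. The knot moves back by one, because a forward difference already sees a jump one
step earlier. -/
theorem fwdDiff_truncBinom (r j : ℕ) :
    fwdDiff 1 (truncBinom (r + 1) (j + 1)) = truncBinom r j := by
  funext t
  unfold fwdDiff truncBinom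
  rcases lt_trichotomy t j with h | h | h
  · rw [if_neg (by omega), if_neg (by omega), if_neg (by omega), sub_zero]
  · subst h
    simp
  · rw [if_pos (by omega), if_pos (by omega), if_pos (by omega)]
    obtain ⟨u, rfl⟩ : ∃ u, t = j + 1 + u := ⟨t - (j + 1), by omega⟩
    have h1 : j + 1 + u + 1 - (j + 1) + (r + 1) = (u + r + 1) + 1 := by omega
    have h2 : j + 1 + u - (j + 1) + (r + 1) = u + r + 1 := by omega
    have h3 : j + 1 + u - j + r = u + r + 1 := by omega
    rw [h1, h2, h3, Nat.choose_succ_succ]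
    push_cast
    ring

theorem fwdDiff_iter_truncBinom (r j t : ℕ) :
    (fwdDiff 1)^[r + 1] (truncBinom r (j + r + 1)) t = if t = j then 1 else 0 := by
  induction r with
  | zero =>
    simp only [zero_add, Function.iterate_one, fwdDiff, truncBinom]
    rcases lt_trichotomy t j with h | h | h
    · rw [if_neg (by omega), if_neg (by omega), if_neg (by omega), sub_zero]
    · subst h
      simp
    · rw [if_pos (by omega), if_pos (by omega), if_neg (by omega)]
      simp
  | succ r ih =>
    rw [Function.iterate_succ_apply, ← add_assoc, fwdDiff_truncBinom, ih]

/-- With knot `l` the truncation is invisible: `t choose l` vanishes for `t < l` by itself. It is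
therefore a polynomial of degree `l < k`, killed by `k` differences. -/
theorem fwdDiff_iter_truncBinom_self (l k : ℕ) (h : l < k) (t : ℕ) :
    (fwdDiff 1)^[k] (truncBinom l l) t = 0 := by
  have h0 : truncBinom l l = fun t : ℕ => ((t.choose l : ℕ) : ℝ) := by
    funext t
    unfold truncBinom
    split_ifs with hl
    · rw [Nat.sub_add_cancel hl]
    · rw [Nat.choose_eq_zero_of_lt (by omega), Nat.cast_zero]
  rw [h0]
  clear h0
  induction k generalizing l t with
  | zero => omega
  | succ k ih =>
    rw [Function.iterate_succ_apply]
    rcases l with _ | l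
    · have : (fwdDiff 1 fun t : ℕ => ((t.choose 0 : ℕ) : ℝ)) = fun _ => 0 := by
        funext t
        simp [fwdDiff]
      rw [this]
      clear ih
      induction k with
      | zero => rfl
      | succ k ih =>
        rw [Function.iterate_succ_apply]
        simpa using ih (by omega)
    · have : (fwdDiff 1 fun t : ℕ => ((t.choose (l + 1) : ℕ) : ℝ)) =
          fun t : ℕ => ((t.choose l : ℕ) : ℝ) := by
        funext t
        simp [fwdDiff, Nat.choose_succ_succ]
      rw [this]
      exact ih l (by omega) t

/-- The `j`-th row of the `k`-th order difference matrix on `ℝ^m`; it vanishes for `j < k`. -/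
def diffVec (m k : ℕ) (j : Fin m) : EuclideanSpace ℝ (Fin m) :=
  WithLp.toLp 2 fun s => if k ≤ (j : ℕ) then (m : ℝ) ^ (k - 1) *
    ∑ l : Fin (k + 1), (-1 : ℝ) ^ (l : ℕ) * (k.choose l : ℝ) *
      (if (⟨(j : ℕ) - (l : ℕ), lt_of_le_of_lt (Nat.sub_le _ _) j.isLt⟩ : Fin m) = s then 1 else 0)
    else 0

theorem diffVec_eq_zero (m k : ℕ) (j : Fin m) (h : (j : ℕ) < k) : diffVec m k j = 0 := by
  ext s
  simp [diffVec, not_le.mpr h]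

theorem inner_diffVec (m k : ℕ) (j : Fin m) (hj : k ≤ (j : ℕ)) (x : EuclideanSpace ℝ (Fin m))
    (f : ℕ → ℝ) (hf : ∀ t : Fin m, x t = f t) :
    inner ℝ (diffVec m k j) x = (m : ℝ) ^ (k - 1) * (fwdDiff 1)^[k] f (j - k) := by
  have h1 : inner ℝ (diffVec m k j) x = (m : ℝ) ^ (k - 1) *
      ∑ l : Fin (k + 1), (-1 : ℝ) ^ (l : ℕ) * (k.choose l : ℝ) * f (j - l) := by
    simp only [PiLp.inner_apply, diffVec, if_pos hj, RCLike.inner_apply, conj_trivial]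
    simp only [Finset.mul_sum]
    rw [Finset.sum_comm]
    refine Finset.sum_congr rfl fun l _ => ?_
    rw [Finset.sum_eq_single (⟨(j : ℕ) - (l : ℕ), lt_of_le_of_lt (Nat.sub_le _ _) j.isLt⟩ : Fin m)]
    · simp [hf]
      ring
    · intro b _ hb
      simp [hb.symm]
    · simp
  rw [h1, fwdDiff_iter_eq_sum_shift]
  congr 1
  -- Reversing the summation turns the backward difference at `j` into the forward difference at `j
  -- - k`.
  rw [Finset.sum_range, ← Equiv.sum_comp Fin.revPerm]
  refine Finset.sum_congr rfl fun l _ => ?_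
  have hl : (l : ℕ) ≤ k := Nat.lt_succ_iff.mp l.isLt
  simp only [Fin.revPerm_apply, Fin.val_rev, smul_eq_mul, mul_one, zsmul_eq_mul]
  have e1 : k + 1 - ((l : ℕ) + 1) = k - l := by omega
  rw [e1, Nat.choose_symm hl, show (j : ℕ) - (k - l) = j - k + l by omega]
  push_cast
  rfl

theorem polySpan_mono (m : ℕ) {r r' : ℕ} (h : r ≤ r') : polySpan m r ≤ polySpan m r' :=
  Submodule.span_mono (Set.image_mono fun _ hx => lt_of_lt_of_le hx h)

theorem phi_mem_polySpan (m l r : ℕ) (h : l < r) : phi m (l + 1) l ∈ polySpan m r :=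
  Submodule.subset_span ⟨l, h, rfl⟩

theorem inner_diffVec_polySpan (m k : ℕ) (j : Fin m) (x : EuclideanSpace ℝ (Fin m))
    (hx : x ∈ polySpan m k) : inner ℝ (diffVec m k j) x = 0 := by
  rcases lt_or_ge (j : ℕ) k with h | hj
  · simp [diffVec_eq_zero m k j h]
  induction hx using Submodule.span_induction with
  | mem x hx =>
    obtain ⟨l, hl, rfl⟩ := hx
    rw [inner_diffVec m k j hj _ (((m : ℝ) ^ l)⁻¹ • truncBinom l l)
      (phi_eq_truncBinom m l l le_rfl), fwdDiff_iter_const_smul, Pi.smul_apply,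
      fwdDiff_iter_truncBinom_self l k hl]
    simp
  | zero => simp
  | add x y _ _ hx hy => rw [inner_add_right, hx, hy, add_zero]
  | smul a x _ hx => rw [inner_smul_right, hx, mul_zero]

/-- Biorthogonality, the source of the whole method. The factor `m^(k-1)` in the difference cancels
the normalisation of the truncated monomial. -/
theorem inner_diffVec_phi (m k : ℕ) (hk : 1 ≤ k) (i j : Fin m) (hj : k ≤ (j : ℕ))
    (hi : k ≤ (i : ℕ)) : inner ℝ (diffVec m k i) (phi m k j) = if i = j then 1 else 0 := by
  obtain ⟨r, rfl⟩ : ∃ r, k = r + 1 := ⟨k - 1, by omega⟩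
  have hm : (m : ℝ) ≠ 0 := by have := i.pos; positivity
  rw [inner_diffVec m _ i hi _ (((m : ℝ) ^ r)⁻¹ • truncBinom r j)
    (phi_eq_truncBinom m r j (by omega)), fwdDiff_iter_const_smul, Pi.smul_apply]
  obtain ⟨u, hu⟩ : ∃ u, (j : ℕ) = u + r + 1 := ⟨j - (r + 1), by omega⟩
  rw [hu, fwdDiff_iter_truncBinom]
  have : ((i : ℕ) - (r + 1) = u) ↔ i = j := by
    rw [Fin.ext_iff]; omega
  simp only [this, Nat.add_sub_cancel, smul_eq_mul]
  field_simp

/-- A vector with vanishing `k`-th differences is a polynomial of degree `< k`. -/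
theorem mem_polySpan_of_inner_diffVec (m k : ℕ) (x : EuclideanSpace ℝ (Fin m))
    (hx : ∀ j, inner ℝ (diffVec m k j) x = 0) : x ∈ polySpan m k := by
  -- The extension by zero beyond `m` is harmless: every difference used below involves only points
  -- smaller than `m`.
  set f : ℕ → ℝ := fun t => if h : t < m then x ⟨t, h⟩ else 0 with hf
  have hxf : ∀ t : Fin m, x t = f t := fun t => by simp [hf]
  have hvan : ∀ t, t + k < m → (fwdDiff 1)^[k] f t = 0 := by
    intro t ht
    have h := hx ⟨t + k, ht⟩
    rw [inner_diffVec m k _ (by simp) x f hxf] at h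
    have hm : (m : ℝ) ≠ 0 := by
      have : 0 < m := by omega
      positivity
    simpa [hm] using h
  have hvan2 : ∀ l, k ≤ l → l < m → (fwdDiff 1)^[l] f 0 = 0 := by
    intro l hkl hl
    obtain ⟨i, rfl⟩ : ∃ i, l = i + k := ⟨l - k, by omega⟩
    rw [Function.iterate_add_apply, fwdDiff_iter_eq_sum_shift]
    refine Finset.sum_eq_zero fun a ha => ?_
    rw [Finset.mem_range] at ha
    rw [hvan _ (by simp; omega), smul_zero]
  -- Newton's forward expansion at 0. Its terms of order `l ≥ k` vanish, being combinations of
  -- `k`-th differences.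
  have hexp : x = ∑ l ∈ Finset.range k,
      ((m : ℝ) ^ l * (fwdDiff 1)^[l] f 0) • phi m (l + 1) l := by
    ext t
    have hm : (m : ℝ) ≠ 0 := by have := t.pos; positivity
    have hN := shift_eq_sum_fwdDiff_iter (1 : ℕ) f t 0
    simp only [zero_add, smul_eq_mul, mul_one] at hN
    rw [hxf t, hN, WithLp.ofLp_sum, Finset.sum_apply]
    have hterm : ∀ l, (((m : ℝ) ^ l * (fwdDiff 1)^[l] f 0) • phi m (l + 1) l) t =
        ((t : ℕ).choose l) • (fwdDiff 1)^[l] f 0 := by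
      intro l
      rw [PiLp.smul_apply, phi_eq_truncBinom m l l le_rfl, truncBinom]
      split_ifs with hl
      · rw [Nat.sub_add_cancel hl, smul_eq_mul, nsmul_eq_mul]
        field_simp
      · rw [Nat.choose_eq_zero_of_lt (by omega)]
        simp
    simp only [hterm]
    rcases le_total k (t + 1) with h | h
    · symm
      refine Finset.sum_subset (Finset.range_mono h) fun l hl hl' => ?_
      rw [Finset.mem_range] at hl hl'
      rw [hvan2 l (by omega) (by omega), smul_zero]
    · refine Finset.sum_subset (Finset.range_mono h) fun l hl hl' => ?_
      rw [Finset.mem_range] at hl hl'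
      rw [Nat.choose_eq_zero_of_lt (by omega), zero_smul]
  rw [hexp]
  exact Submodule.sum_mem _ fun l hl =>
    Submodule.smul_mem _ _ (phi_mem_polySpan m l k (Finset.mem_range.mp hl))

theorem dict_of_le (m k j : ℕ) (h : k ≤ j) :
    dict m k j = (polySpan m k)ᗮ.starProjection (phi m k j) := by
  rw [dict, if_neg (by omega)]

theorem dict_mem_orthogonal (m k j : ℕ) (h : k ≤ j) : dict m k j ∈ (polySpan m k)ᗮ := by
  rw [dict_of_le m k j h]
  exact Submodule.starProjection_apply_mem _ _

theorem phi_sub_dict_mem (m k j : ℕ) (h : k ≤ j) : phi m k j - dict m k j ∈ polySpan m k := by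
  rw [dict_of_le m k j h, Submodule.starProjection_orthogonal_val, sub_sub_cancel]
  exact Submodule.starProjection_apply_mem _ _

theorem inner_diffVec_dict (m k : ℕ) (hk : 1 ≤ k) (i j : Fin m) (hj : k ≤ (j : ℕ))
    (hi : k ≤ (i : ℕ)) : inner ℝ (diffVec m k i) (dict m k j) = if i = j then 1 else 0 := by
  rw [← inner_diffVec_phi m k hk i j hj hi, ← sub_eq_zero, ← inner_sub_right, ← neg_sub,
    inner_neg_right, inner_diffVec_polySpan m k i _ (phi_sub_dict_mem m k j hj), neg_zero]

/-- Discrete Taylor formula: by biorthogonality the difference has no `k`-th differences left, so it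
is a polynomial. -/
theorem sub_sum_smul_phi_mem (m k : ℕ) (hk : 1 ≤ k) (x : EuclideanSpace ℝ (Fin m)) :
    x - ∑ j : Fin m, inner ℝ (diffVec m k j) x • phi m k j ∈ polySpan m k := by
  refine mem_polySpan_of_inner_diffVec m k _ fun i => ?_
  rcases lt_or_ge (i : ℕ) k with h | hi
  · simp [diffVec_eq_zero m k i h]
  rw [inner_sub_right, inner_sum, Finset.sum_eq_single i, inner_smul_right,
    inner_diffVec_phi m k hk i i hi hi, if_pos rfl, mul_one, sub_self]
  · intro j _ hj
    rcases lt_or_ge (j : ℕ) k with h | hj'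
    · simp [diffVec_eq_zero m k j h]
    · rw [inner_smul_right, inner_diffVec_phi m k hk i j hj' hi, if_neg hj.symm, mul_zero]
  · simp

/-- The dictionary vectors of index `≥ k` lie in the row space of the difference matrix. -/
theorem dict_eq_sum_diffVec (m k : ℕ) (hk : 1 ≤ k) (t : Fin m) (ht : k ≤ (t : ℕ)) :
    dict m k t = ∑ j : Fin m, inner ℝ (dict m k j) (dict m k t) • diffVec m k j := by
  refine ext_inner_left ℝ fun x => ?_
  -- Tested against `x`: the polynomial part of `x` is invisible to `dict m k t`, and for the same
  -- reason each `phi m k j` may be replaced by `dict m k j`.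
  have h1 := Submodule.inner_right_of_mem_orthogonal (sub_sum_smul_phi_mem m k hk x)
    (dict_mem_orthogonal m k t ht)
  rw [inner_sub_left, sub_eq_zero] at h1
  rw [h1, sum_inner, inner_sum]
  refine Finset.sum_congr rfl fun j _ => ?_
  rw [real_inner_smul_left, inner_smul_right, real_inner_comm x]
  rcases lt_or_ge (j : ℕ) k with h | hj
  · simp [diffVec_eq_zero m k j h]
  have h2 := Submodule.inner_right_of_mem_orthogonal (phi_sub_dict_mem m k j hj)
    (dict_mem_orthogonal m k t ht)
  rw [inner_sub_left, sub_eq_zero] at h2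
  rw [h2]
  ring

theorem dict_mem_polySpan (m k j : ℕ) (h : j < k) : dict m k j ∈ polySpan m (j + 1) := by
  rw [dict, if_pos h, Submodule.starProjection_orthogonal_val]
  exact Submodule.smul_mem _ _ (Submodule.sub_mem _ (phi_mem_polySpan m j _ (by omega))
    (polySpan_mono m (Nat.le_succ j) (Submodule.starProjection_apply_mem _ _)))

theorem inner_dict_eq_zero_of_lt (m k i j : ℕ) (hij : i < j) (hi : i < k) :
    inner ℝ (dict m k i) (dict m k j) = 0 := by
  rcases lt_or_ge j k with h | h
  · refine Submodule.inner_right_of_mem_orthogonal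
      (polySpan_mono m hij (dict_mem_polySpan m k i hi)) ?_
    rw [dict, if_pos h]
    exact Submodule.smul_mem _ _ (Submodule.starProjection_apply_mem _ _)
  · exact Submodule.inner_right_of_mem_orthogonal
      (polySpan_mono m hi (dict_mem_polySpan m k i hi)) (dict_mem_orthogonal m k j h)

theorem inner_dict_eq_zero (m k i j : ℕ) (hij : i ≠ j) (h : i < k ∨ j < k) :
    inner ℝ (dict m k i) (dict m k j) = 0 := by
  rcases lt_or_gt_of_ne hij with h1 | h1
  · exact inner_dict_eq_zero_of_lt m k i j h1 (by omega)
  · rw [real_inner_comm]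
    exact inner_dict_eq_zero_of_lt m k j i h1 (by omega)

/-- Gram–Schmidt is triangular, and the rescaling factors are nonzero because the rescaled vectors
have norm √m > 0. -/
theorem polySpan_le_span_dict (m k : ℕ) (hkm : k ≤ m) (r : ℕ) (hr : r ≤ k) :
    polySpan m r ≤ Submodule.span ℝ (Set.range fun j : Fin m => dict m k j) := by
  induction r with
  | zero => simp [polySpan]
  | succ r ih =>
    refine Submodule.span_le.mpr ?_
    rintro _ ⟨l, hl, rfl⟩
    rcases Nat.lt_succ_iff_lt_or_eq.mp hl with h | rfl
    · exact ih (by omega) (phi_mem_polySpan m l r h)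
    have hd : dict m k l = (√(m : ℝ) / ‖(polySpan m l)ᗮ.starProjection (phi m (l + 1) l)‖) •
        (polySpan m l)ᗮ.starProjection (phi m (l + 1) l) := by
      rw [dict, if_pos (by omega)]
    have hn := norm_dict m k l (by omega) (by omega)
    have hc : √(m : ℝ) / ‖(polySpan m l)ᗮ.starProjection (phi m (l + 1) l)‖ ≠ 0 := by
      intro h0
      rw [hd, h0, zero_smul, norm_zero] at hn
      have : (0 : ℝ) < m := by exact_mod_cast (show 0 < m by omega)
      exact (Real.sqrt_pos.mpr this).ne hn
    have hmem : (polySpan m l)ᗮ.starProjection (phi m (l + 1) l) ∈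
        Submodule.span ℝ (Set.range fun j : Fin m => dict m k j) := by
      rw [← Submodule.smul_mem_iff _ hc, ← hd]
      exact Submodule.subset_span ⟨⟨l, by omega⟩, rfl⟩
    have h2 := Submodule.add_mem _ hmem
      (ih (by omega) (Submodule.starProjection_apply_mem (polySpan m l) (phi m (l + 1) l)))
    rwa [Submodule.starProjection_orthogonal_val, sub_add_cancel] at h2

theorem span_dict_eq_top (m k : ℕ) (hk : 1 ≤ k) (hkm : k ≤ m) :
    Submodule.span ℝ (Set.range fun j : Fin m => dict m k j) = ⊤ := by
  rw [eq_top_iff]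
  intro x _
  have hp := polySpan_le_span_dict m k hkm k le_rfl
  have h1 := Submodule.add_mem _ (hp (sub_sum_smul_phi_mem m k hk x))
    (Submodule.sum_mem (t := Finset.univ) _ fun (j : Fin m) _ =>
      show inner ℝ (diffVec m k j) x • phi m k j ∈
        Submodule.span ℝ (Set.range fun j : Fin m => dict m k j) from ?_)
  · rwa [sub_add_cancel] at h1
  rcases lt_or_ge (j : ℕ) k with h | hj
  · simp [diffVec_eq_zero m k j h]
  refine Submodule.smul_mem _ _ ?_
  rw [← sub_add_cancel (phi m k j) (dict m k j)]
  exact Submodule.add_mem _ (hp (phi_sub_dict_mem m k j hj)) (Submodule.subset_span ⟨j, rfl⟩)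

end OneDimensional

/-! ### Piecewise polynomial approximation of truncated monomials. -/

section SplineApproximation

/-- To the right of the knot the binomial is a rising factorial divided by `r!`, a polynomial in `t`
of degree `r`. -/
theorem exists_polynomial_eq_truncBinom (r j : ℕ) :
    ∃ c : Fin (r + 1) → ℝ, ∀ t, j ≤ t →
      truncBinom r j t = ∑ a : Fin (r + 1), c a * (t : ℝ) ^ (a : ℕ) := by
  set p : Polynomial ℝ := Polynomial.C ((r.factorial : ℝ)⁻¹) *
    (ascPochhammer ℝ r).comp (Polynomial.X + Polynomial.C (1 - (j : ℝ))) with hp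
  have hdeg : p.natDegree < r + 1 := by
    refine Nat.lt_succ_of_le ((Polynomial.natDegree_C_mul_le _ _).trans ?_)
    rw [Polynomial.natDegree_comp, ascPochhammer_natDegree, Polynomial.natDegree_X_add_C, mul_one]
  refine ⟨fun a => p.coeff a, fun t ht => ?_⟩
  rw [Fin.sum_univ_eq_sum_range (fun a => p.coeff a * (t : ℝ) ^ a) (r + 1),
    ← Polynomial.eval_eq_sum_range' hdeg (t : ℝ), hp, truncBinom, if_pos ht]
  obtain ⟨u, rfl⟩ : ∃ u, t = j + u := ⟨t - j, by omega⟩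
  have h1 : (ascPochhammer ℝ r).eval ((u : ℝ) + 1) = ((u + 1).ascFactorial r : ℕ) := by
    rw [← ascPochhammer_nat_eq_ascFactorial, ascPochhammer_eval_cast, Nat.cast_add, Nat.cast_one]
  rw [Polynomial.eval_mul, Polynomial.eval_C, Polynomial.eval_comp, Polynomial.eval_add,
    Polynomial.eval_X, Polynomial.eval_C, show ((j + u : ℕ) : ℝ) + (1 - (j : ℝ)) = (u : ℝ) + 1 by
      push_cast; ring, h1, Nat.ascFactorial_eq_factorial_mul_choose, Nat.add_sub_cancel_left]
  have : (r.factorial : ℝ) ≠ 0 := by positivity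
  push_cast
  field_simp

/-- Within distance `m / N` of its knot a truncated monomial of degree `r` is still small. The
additive `r` in the binomial is absorbed by `r ≤ r m / N`. -/
theorem abs_phi_le (m r j N : ℕ) (hr : r ≤ j) (hN : 0 < N) (hNm : N ≤ m) (t : Fin m)
    (h : ((t : ℕ) - j) * N ≤ m) : |phi m (r + 1) j t| ≤ ((r + 1 : ℝ) / N) ^ r := by
  have hm : (0 : ℝ) < m := by exact_mod_cast t.pos
  have hN' : (0 : ℝ) < N := by exact_mod_cast hN
  rw [phi_eq_truncBinom m r j hr, truncBinom]
  split_ifs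
  · rw [abs_of_nonneg (by positivity), inv_mul_le_iff₀ (by positivity), ← mul_pow]
    have h1 : (((t : ℕ) - j + r).choose r : ℝ) ≤ (((t : ℕ) - j + r : ℕ) : ℝ) ^ r := by
      exact_mod_cast Nat.choose_le_pow _ _
    refine h1.trans (pow_le_pow_left₀ (by positivity) ?_ r)
    have h2 : (((t : ℕ) - j : ℕ) : ℝ) * N ≤ m := by exact_mod_cast h
    have h3 : (N : ℝ) ≤ m := by exact_mod_cast hNm
    rw [mul_div_assoc', le_div_iff₀ hN']
    push_cast
    nlinarith [mul_le_mul_of_nonneg_left h3 (Nat.cast_nonneg (α := ℝ) r)]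
  · simp only [mul_zero, abs_zero]
    positivity

theorem norm_phi_sq_le (m r j : ℕ) (hr : r ≤ j) (hj : j < m) :
    ‖phi m (r + 1) j‖ ^ 2 ≤ 2 * (r + 1 : ℝ) ^ (2 * r) * m := by
  rw [EuclideanSpace.real_norm_sq_eq]
  have h : ∀ t ∈ Finset.univ, phi m (r + 1) j t ^ 2 ≤ (r + 1 : ℝ) ^ (2 * r) := by
    intro t _
    have ht := t.isLt
    have := abs_phi_le m r j 1 hr one_pos (by omega) t (by omega)
    rw [Nat.cast_one, div_one] at this
    rw [← sq_abs, mul_comm 2 r, pow_mul]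
    exact pow_le_pow_left₀ (abs_nonneg _) this 2
  refine (Finset.sum_le_sum h).trans ?_
  rw [Finset.sum_const, Finset.card_univ, Fintype.card_fin, nsmul_eq_mul]
  have : (0 : ℝ) ≤ m * (r + 1 : ℝ) ^ (2 * r) := by positivity
  linarith

theorem card_block_le (m N j : ℕ) (hN : 0 < N) (hNm : N ≤ m) :
    ((Finset.univ.filter fun t : Fin m => j ≤ (t : ℕ) ∧ ((t : ℕ) - j) * N ≤ m).card : ℝ) ≤
      2 * m / N := by
  have hN' : (0 : ℝ) < N := by exact_mod_cast hN
  have h1 : (Finset.univ.filter fun t : Fin m => j ≤ (t : ℕ) ∧ ((t : ℕ) - j) * N ≤ m).card ≤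
      (Finset.range (m / N + 1)).card := by
    refine Finset.card_le_card_of_injOn (fun t => (t : ℕ) - j) ?_ ?_
    · intro t ht
      simp only [Finset.coe_filter, Finset.mem_univ, true_and, Set.mem_ofPred_eq] at ht
      simp only [Finset.coe_range, Set.mem_Iio]
      exact Nat.lt_succ_of_le ((Nat.le_div_iff_mul_le hN).mpr ht.2)
    · intro t ht t' ht' h
      simp only [Finset.coe_filter, Finset.mem_univ, true_and, Set.mem_ofPred_eq] at ht ht'
      simp only at h
      exact Fin.ext (by omega)
  rw [Finset.card_range] at h1
  have h2 : ((m / N : ℕ) : ℝ) ≤ m / N := Nat.cast_div_le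
  have h3 : (1 : ℝ) ≤ m / N := by
    rw [le_div_iff₀ hN', one_mul]
    exact_mod_cast hNm
  calc _ ≤ ((m / N + 1 : ℕ) : ℝ) := by exact_mod_cast h1
    _ ≤ m / N + m / N := by push_cast; linarith
    _ = 2 * m / N := by ring

/-- Truncated monomials are approximated by piecewise polynomials on `2^l` blocks. -/
theorem exists_piecewise_approx (m r l : ℕ) :
    ∃ V : Submodule ℝ (EuclideanSpace ℝ (Fin m)), Module.finrank ℝ V ≤ (r + 1) * 2 ^ l ∧
      ∀ j, r ≤ j → j < m → ∃ p ∈ V,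
        ‖phi m (r + 1) j - p‖ ^ 2 ≤ 2 * (r + 1 : ℝ) ^ (2 * r) * m * ((1 / 2) ^ (2 * r + 1)) ^ l ∧
        (m ≤ 2 ^ l → p = phi m (r + 1) j) := by
  -- At fine scales the whole space fits the dimension budget and the approximation is exact, which
  -- makes the later telescoping sums finite.
  rcases le_or_gt m (2 ^ l) with hml | hml
  · refine ⟨⊤, ?_, fun j _ _ => ⟨_, Submodule.mem_top, ?_, fun _ => rfl⟩⟩
    · rw [finrank_top, finrank_euclideanSpace, Fintype.card_fin]
      exact hml.trans (Nat.le_mul_of_pos_left _ (by omega))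
    · rw [sub_self, norm_zero, zero_pow two_ne_zero]
      positivity
  set N := 2 ^ l with hN
  have hN0 : 0 < N := by positivity
  have hm0 : 0 < m := by omega
  let blk : Fin m → Fin N := fun t => ⟨(t : ℕ) * N / m, by
    rw [Nat.div_lt_iff_lt_mul hm0, mul_comm]
    exact Nat.mul_lt_mul_of_pos_left t.isLt hN0⟩
  let v : Fin N × Fin (r + 1) → EuclideanSpace ℝ (Fin m) := fun b =>
    WithLp.toLp 2 fun t => if blk t = b.1 then ((t : ℕ) : ℝ) ^ (b.2 : ℕ) else 0
  refine ⟨Submodule.span ℝ (Set.range v), ?_, fun j hrj hj => ?_⟩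
  · refine (finrank_range_le_card v).trans ?_
    simp [mul_comm]
  obtain ⟨c, hc⟩ := exists_polynomial_eq_truncBinom r j
  let jj : Fin m := ⟨j, hj⟩
  -- The approximant drops the block of the knot. On every later block the monomial is a single
  -- polynomial, and on every earlier one it is zero.
  let p : EuclideanSpace ℝ (Fin m) := WithLp.toLp 2 fun t =>
    if blk jj < blk t then phi m (r + 1) j t else 0
  have hmono : ∀ t t' : Fin m, t ≤ t' → blk t ≤ blk t' := fun t t' h =>
    Nat.div_le_div_right (Nat.mul_le_mul_right _ h)
  have hp : p = ∑ b : Fin N × Fin (r + 1),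
      (if blk jj < b.1 then ((m : ℝ) ^ r)⁻¹ * c b.2 else 0) • v b := by
    ext t
    rw [WithLp.ofLp_sum, Finset.sum_apply, Fintype.sum_prod_type, Finset.sum_eq_single (blk t)]
    · simp only [p, v, PiLp.smul_apply, smul_eq_mul, if_true]
      split_ifs with h
      · have hjt : j ≤ (t : ℕ) := by
          by_contra hcon
          exact absurd (hmono t jj (by simp only [Fin.le_def, jj]; omega)) (not_le.mpr h)
        rw [phi_eq_truncBinom m r j hrj, hc _ hjt, Finset.mul_sum]
        exact Finset.sum_congr rfl fun a _ => by ring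
      · simp
    · intro b _ hb
      exact Finset.sum_eq_zero fun a _ => by simp [v, hb.symm, PiLp.smul_apply, -ite_smul]
    · simp
  refine ⟨p, ?_, ?_, fun h => absurd h (by omega)⟩
  · rw [hp]
    exact Submodule.sum_mem _ fun b _ => Submodule.smul_mem _ _ (Submodule.subset_span ⟨b, rfl⟩)
  rw [EuclideanSpace.real_norm_sq_eq]
  have hN' : (0 : ℝ) < N := by exact_mod_cast hN0
  have hterm : ∀ t ∈ Finset.univ, (phi m (r + 1) j - p) t ^ 2 ≤
      if j ≤ (t : ℕ) ∧ ((t : ℕ) - j) * N ≤ m then (((r + 1 : ℝ) / N) ^ r) ^ 2 else 0 := by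
    intro t _
    rw [PiLp.sub_apply]
    simp only [p]
    by_cases h : blk jj < blk t
    · rw [if_pos h, sub_self, zero_pow two_ne_zero]
      positivity
    rw [if_neg h, sub_zero]
    by_cases hjt : j ≤ (t : ℕ)
    · have hb : blk t = blk jj := le_antisymm (not_lt.mp h) (hmono jj t hjt)
      have hb' : (t : ℕ) * N / m = j * N / m := congrArg Fin.val hb
      have h1 := Nat.div_add_mod ((t : ℕ) * N) m
      have h2 := Nat.div_add_mod (j * N) m
      have h3 := Nat.mod_lt ((t : ℕ) * N) hm0
      have h4 : ((t : ℕ) - j) * N ≤ m := by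
        rw [Nat.sub_mul]
        rw [hb'] at h1
        omega
      rw [if_pos ⟨hjt, h4⟩, ← sq_abs]
      exact pow_le_pow_left₀ (abs_nonneg _) (abs_phi_le m r j N hrj hN0 hml.le t h4) 2
    · rw [if_neg (by tauto), phi_eq_truncBinom m r j hrj, truncBinom, if_neg hjt]
      simp
  refine (Finset.sum_le_sum hterm).trans ?_
  -- The error lives on at most `2m/N` points and has size at most `((r+1)/N)^r` there, hence the
  -- power `N^(-(2r+1))`.
  rw [← Finset.sum_filter, Finset.sum_const, nsmul_eq_mul]
  refine (mul_le_mul_of_nonneg_right (card_block_le m N j hN0 hml.le) (by positivity)).trans_eq ?_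
  have : ((1 / 2 : ℝ) ^ (2 * r + 1)) ^ l = (((N : ℝ)) ^ (2 * r + 1))⁻¹ := by
    rw [hN, ← pow_mul, mul_comm _ l, pow_mul]
    push_cast
    rw [one_div, inv_pow, inv_pow]
  rw [this, ← pow_mul, mul_comm r 2, div_pow, pow_succ]
  field_simp

/-- The decay factor of the approximation error of the dictionary vectors of order `k` from one
dyadic scale to the next. -/
def decay (k : ℕ) : ℝ := (2 : ℝ) ^ (-((2 * k - 1) / 2 : ℝ))

theorem decay_pos (k : ℕ) : 0 < decay k := Real.rpow_pos_of_pos two_pos _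

theorem decay_sq (r : ℕ) : decay (r + 1) ^ 2 = (1 / 2) ^ (2 * r + 1) := by
  rw [decay, ← Real.rpow_natCast, ← Real.rpow_mul zero_le_two, one_div, inv_pow,
    ← Real.rpow_natCast, ← Real.rpow_neg zero_le_two]
  congr 1
  push_cast
  ring

/-- Multiscale expansion of the dictionary vectors of index `≥ k`. -/
theorem exists_multiscale (k : ℕ) (hk : 1 ≤ k) : ∃ C : ℝ, 1 ≤ C ∧ ∀ m : ℕ,
    ∃ W : ℕ → Submodule ℝ (EuclideanSpace ℝ (Fin m)),
      (∀ l, (Module.finrank ℝ (W l) : ℝ) ≤ C * 2 ^ l) ∧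
      ∀ j, k ≤ j → j < m → ∃ ψ : ℕ → EuclideanSpace ℝ (Fin m),
        (∀ l, ψ l ∈ W l) ∧ (∀ l, ‖ψ l‖ ≤ C * √(m : ℝ) * decay k ^ l) ∧
        ∀ T, m < T → ∑ l ∈ Finset.range T, ψ l = dict m k j := by
  obtain ⟨r, rfl⟩ : ∃ r, k = r + 1 := ⟨k - 1, by omega⟩
  set D : ℝ := √(2 * (r + 1 : ℝ) ^ (2 * r)) with hD
  have hρ := decay_pos (r + 1)
  set ρ := decay (r + 1) with hρdef
  have hD0 : 0 ≤ D := Real.sqrt_nonneg _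
  -- One constant for two purposes: `2(r+1)` bounds the dimension of two consecutive spline spaces,
  -- while `D(1+ρ⁻¹)` and `2D` bound the increments and the initial term.
  refine ⟨2 * (r + 1) + 2 * D * (1 + ρ⁻¹), ?_, fun m => ?_⟩
  · have : 0 ≤ 2 * D * (1 + ρ⁻¹) := by positivity
    have : (0 : ℝ) ≤ r := by positivity
    linarith
  set C : ℝ := 2 * (r + 1) + 2 * D * (1 + ρ⁻¹) with hC
  set A : EuclideanSpace ℝ (Fin m) →L[ℝ] EuclideanSpace ℝ (Fin m) :=
    (polySpan m (r + 1))ᗮ.starProjection with hA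
  choose V hVdim hV using fun l => exists_piecewise_approx m r l
  have hsq : ∀ (x : EuclideanSpace ℝ (Fin m)) (l : ℕ),
      ‖x‖ ^ 2 ≤ 2 * (r + 1 : ℝ) ^ (2 * r) * m * ((1 / 2) ^ (2 * r + 1)) ^ l →
      ‖A x‖ ≤ D * √(m : ℝ) * ρ ^ l := by
    intro x l hx
    refine (Submodule.norm_starProjection_apply_le _ x).trans ?_
    rw [← decay_sq, pow_right_comm] at hx
    refine abs_le_of_sq_le_sq' ?_ (by positivity) |>.2
    rw [mul_pow, mul_pow, hD, Real.sq_sqrt (by positivity), Real.sq_sqrt (by positivity)]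
    exact hx
  have hmap : ∀ l, Module.finrank ℝ ((V l).map A.toLinearMap) ≤ (r + 1) * 2 ^ l := fun l =>
    (Submodule.finrank_map_le _ _).trans (hVdim l)
  refine ⟨fun l => (V l).map A.toLinearMap ⊔ (V (l - 1)).map A.toLinearMap, fun l => ?_,
    fun j hkj hj => ?_⟩
  · have h1 := Submodule.finrank_add_le_finrank_add_finrank ((V l).map A.toLinearMap)
      ((V (l - 1)).map A.toLinearMap)
    have h2 := hmap l
    have h3 := (hmap (l - 1)).trans
      (Nat.mul_le_mul_left (r + 1) (Nat.pow_le_pow_right two_pos (Nat.sub_le l 1)))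
    have h4 : (Module.finrank ℝ ((V l).map A.toLinearMap ⊔ (V (l - 1)).map A.toLinearMap :
        Submodule ℝ (EuclideanSpace ℝ (Fin m))) : ℝ) ≤ (2 * (r + 1) : ℝ) * 2 ^ l := by
      have : Module.finrank ℝ ((V l).map A.toLinearMap ⊔ (V (l - 1)).map A.toLinearMap :
        Submodule ℝ (EuclideanSpace ℝ (Fin m))) ≤ (2 * (r + 1)) * 2 ^ l := by
        rw [mul_assoc]
        omega
      exact_mod_cast this
    refine h4.trans (mul_le_mul_of_nonneg_right ?_ (by positivity))
    have : 0 ≤ 2 * D * (1 + ρ⁻¹) := by positivity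
    linarith
  choose p hpV hp hpm using fun l => hV l j (by omega) hj
  have hdict : dict m (r + 1) j = A (phi m (r + 1) j) := dict_of_le m (r + 1) j hkj
  -- Increments of successive approximations, starting from the coarsest one; the projection `A` off
  -- the polynomials turns `phi` into `dict` and does not increase errors.
  refine ⟨fun l => Nat.casesOn l (A (p 0)) fun i => A (p (i + 1)) - A (p i), ?_, ?_, ?_⟩
  · rintro (_ | i)
    · exact Submodule.mem_sup_left (Submodule.mem_map_of_mem (hpV 0))
    · exact Submodule.sub_mem _ (Submodule.mem_sup_left (Submodule.mem_map_of_mem (hpV _)))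
        (Submodule.mem_sup_right (Submodule.mem_map_of_mem (hpV i)))
  · have hCD : D * (1 + ρ⁻¹) ≤ C ∧ D + D ≤ C := by
      have h1 : 0 ≤ D * ρ⁻¹ := by positivity
      have h2 : (0 : ℝ) ≤ r := by positivity
      constructor <;> · rw [hC]; nlinarith
    have key : ∀ l, ‖A (phi m (r + 1) j) - A (p l)‖ ≤ D * √(m : ℝ) * ρ ^ l := fun l => by
      rw [← map_sub]
      exact hsq _ l (hp l)
    rintro (_ | i)
    · have h1 := hsq (phi m (r + 1) j) 0 (by simpa using norm_phi_sq_le m r j (by omega) hj)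
      have h2 := norm_sub_norm_le (A (p 0)) (A (phi m (r + 1) j))
      rw [norm_sub_rev] at h2
      have h3 := key 0
      rw [pow_zero, mul_one] at *
      calc ‖A (p 0)‖ ≤ (D + D) * √(m : ℝ) := by linarith
        _ ≤ C * √(m : ℝ) := mul_le_mul_of_nonneg_right hCD.2 (by positivity)
    · have h1 := key i
      have h2 := key (i + 1)
      have h3 : ‖A (p (i + 1)) - A (p i)‖ ≤ D * √(m : ℝ) * ρ ^ i + D * √(m : ℝ) * ρ ^ (i + 1) := by
        refine (le_trans ?_ (add_le_add h1 h2))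
        rw [← norm_neg (A (phi m (r + 1) j) - A (p (i + 1)))]
        refine le_trans (le_of_eq ?_) (norm_add_le _ _)
        congr 1
        abel
      refine h3.trans (le_trans (le_of_eq ?_)
        (mul_le_mul_of_nonneg_right (mul_le_mul_of_nonneg_right hCD.1 (Real.sqrt_nonneg (m : ℝ)))
          (by positivity : 0 ≤ ρ ^ (i + 1))))
      rw [pow_succ]
      field_simp
      ring
  · rintro (_ | T) hT
    · omega
    have hsum : ∀ T, ∑ l ∈ Finset.range (T + 1), (Nat.casesOn l (A (p 0))
        fun i => A (p (i + 1)) - A (p i) : EuclideanSpace ℝ (Fin m)) = A (p T) := by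
      intro T
      induction T with
      | zero => simp
      | succ T ih =>
        rw [Finset.sum_range_succ, ih]
        simp
    -- The sum telescopes to the last approximation, which is exact since `m ≤ T < 2^T`.
    rw [hsum, hpm T ((Nat.lt_succ_iff.mp hT).trans Nat.lt_two_pow_self.le), hdict]

end SplineApproximation

/-! ### Outer products and total differences. -/

section PureTensors

variable {ι : Type*} [Fintype ι] [DecidableEq ι]

/-- The outer product `⨂ᵢ vᵢ`. -/
def pureTensor (n : ι → ℕ) (v : ∀ i, EuclideanSpace ℝ (Fin (n i))) : Tensor n :=
  WithLp.toLp 2 fun j => ∏ i, v i (j i)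

theorem atom_eq_pureTensor (n : ι → ℕ) (k : ℕ) (κ : Idx n) :
    atom n k κ = pureTensor n fun i => dict (n i) k (κ i) := rfl

theorem inner_pureTensor (n : ι → ℕ) (v w : ∀ i, EuclideanSpace ℝ (Fin (n i))) :
    inner ℝ (pureTensor n v) (pureTensor n w) = ∏ i, inner ℝ (v i) (w i) := by
  simp only [PiLp.inner_apply, pureTensor, RCLike.inner_apply, conj_trivial,
    ← Finset.prod_mul_distrib]
  exact (Fintype.prod_sum fun i t => w i t * v i t).symm

theorem norm_pureTensor (n : ι → ℕ) (v : ∀ i, EuclideanSpace ℝ (Fin (n i))) :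
    ‖pureTensor n v‖ = ∏ i, ‖v i‖ := by
  refine (sq_eq_sq₀ (norm_nonneg _) (Finset.prod_nonneg fun _ _ => norm_nonneg _)).mp ?_
  rw [← real_inner_self_eq_norm_sq, inner_pureTensor, ← Finset.prod_pow]
  exact Finset.prod_congr rfl fun i _ => real_inner_self_eq_norm_sq _

theorem pureTensor_sum (n : ι → ℕ) {α : ι → Type*} (s : ∀ i, Finset (α i))
    (w : ∀ i, α i → EuclideanSpace ℝ (Fin (n i))) :
    pureTensor n (fun i => ∑ a ∈ s i, w i a) =
      ∑ f ∈ Fintype.piFinset s, pureTensor n fun i => w i (f i) := by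
  ext j
  simp only [pureTensor, WithLp.ofLp_sum, Finset.sum_apply]
  exact Finset.prod_univ_sum _ _

theorem pureTensor_smul (n : ι → ℕ) (c : ι → ℝ) (w : ∀ i, EuclideanSpace ℝ (Fin (n i))) :
    pureTensor n (fun i => c i • w i) = (∏ i, c i) • pureTensor n w := by
  ext j
  simp [pureTensor, Finset.prod_mul_distrib]

theorem pureTensor_eq_zero (n : ι → ℕ) (w : ∀ i, EuclideanSpace ℝ (Fin (n i))) (i : ι)
    (h : w i = 0) : pureTensor n w = 0 := by
  ext j
  simp only [pureTensor]
  exact Finset.prod_eq_zero (Finset.mem_univ i) (by simp [h])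

/-- Makes the total difference a linear functional with a product structure. The extension by zero
is consistent because a factor `diffVec` with index below `k` vanishes. -/
theorem totalDiff_eq_inner (n : ι → ℕ) (k : ℕ) (f : Tensor n) (j : Idx n) :
    totalDiff n k f j = inner ℝ (pureTensor n fun i => diffVec (n i) k (j i)) f := by
  unfold totalDiff
  split_ifs with h
  · simp only [PiLp.inner_apply, pureTensor, RCLike.inner_apply, conj_trivial, diffVec, h,
      if_true, Finset.prod_mul_distrib]
    have h1 : ∀ s : Idx n, (∏ i, ∑ l : Fin (k + 1), (-1 : ℝ) ^ (l : ℕ) * (k.choose l : ℝ) *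
        (if (⟨(j i : ℕ) - (l : ℕ), lt_of_le_of_lt (Nat.sub_le _ _) (j i).isLt⟩ : Fin (n i)) = s i
          then 1 else 0)) =
        ∑ l : ι → Fin (k + 1), (∏ i, ((-1 : ℝ) ^ (l i : ℕ) * (k.choose (l i) : ℝ))) *
          if (fun i => (⟨(j i : ℕ) - (l i : ℕ),
            lt_of_le_of_lt (Nat.sub_le _ _) (j i).isLt⟩ : Fin (n i))) = s then 1 else 0 := by
      intro s
      rw [Fintype.prod_sum]
      refine Finset.sum_congr rfl fun l _ => ?_
      rw [Finset.prod_mul_distrib]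
      congr 1
      rw [Fintype.prod_boole]
      simp only [funext_iff]
    simp only [h1]
    rw [Finset.mul_sum]
    simp only [Finset.mul_sum]
    rw [Finset.sum_comm]
    refine Finset.sum_congr rfl fun l _ => ?_
    rw [Finset.sum_eq_single (fun i => (⟨(j i : ℕ) - (l i : ℕ),
            lt_of_le_of_lt (Nat.sub_le _ _) (j i).isLt⟩ : Fin (n i)))]
    · rw [if_pos rfl, Finset.prod_mul_distrib]
      ring
    · intro b _ hb
      rw [if_neg hb.symm]
      ring
    · simp
  · push Not at h
    obtain ⟨i, hi⟩ := h
    rw [pureTensor_eq_zero n _ i (diffVec_eq_zero _ _ _ hi), inner_zero_left]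

end PureTensors

/-! ### The row space and trend filtering inside it. -/

section RowSpace

variable {ι : Type*} [Fintype ι] [DecidableEq ι]

/-- The span of the dictionary tensors all of whose indices are `≥ k`. -/
def rowSpace (n : ι → ℕ) (k : ℕ) : Submodule ℝ (Tensor n) :=
  Submodule.span ℝ (atom n k '' {κ | ∀ i, k ≤ (κ i : ℕ)})

/-- The component of a tensor in the row space, expressed through its total differences. -/
def rowPart (n : ι → ℕ) (k : ℕ) (w : Tensor n) : Tensor n :=
  ∑ a : Idx n, totalDiff n k w a • atom n k a

theorem totalDiff_of_lt (n : ι → ℕ) (k : ℕ) (w : Tensor n) (a : Idx n)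
    (h : ¬ ∀ i, k ≤ (a i : ℕ)) : totalDiff n k w a = 0 := if_neg h

theorem totalDiff_atom (n : ι → ℕ) (k : ℕ) (hk : 1 ≤ k) (a b : Idx n)
    (ha : ∀ i, k ≤ (a i : ℕ)) (hb : ∀ i, k ≤ (b i : ℕ)) :
    totalDiff n k (atom n k a) b = if b = a then 1 else 0 := by
  rw [totalDiff_eq_inner, atom_eq_pureTensor, inner_pureTensor,
    Finset.prod_congr rfl fun i _ => inner_diffVec_dict _ k hk (b i) (a i) (ha i) (hb i),
    Fintype.prod_boole]
  simp only [funext_iff]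

theorem totalDiff_add (n : ι → ℕ) (k : ℕ) (v w : Tensor n) (a : Idx n) :
    totalDiff n k (v + w) a = totalDiff n k v a + totalDiff n k w a := by
  simp only [totalDiff_eq_inner, inner_add_right]

theorem totalDiff_smul (n : ι → ℕ) (k : ℕ) (c : ℝ) (w : Tensor n) (a : Idx n) :
    totalDiff n k (c • w) a = c * totalDiff n k w a := by
  simp only [totalDiff_eq_inner, inner_smul_right]

theorem totalDiff_rowPart (n : ι → ℕ) (k : ℕ) (hk : 1 ≤ k) (w : Tensor n) (b : Idx n) :
    totalDiff n k (rowPart n k w) b = totalDiff n k w b := by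
  by_cases hb : ∀ i, k ≤ (b i : ℕ)
  · rw [rowPart, totalDiff_eq_inner, inner_sum, Finset.sum_eq_single b]
    · rw [inner_smul_right, ← totalDiff_eq_inner, totalDiff_atom n k hk b b hb hb, if_pos rfl,
        mul_one]
    · intro a _ hab
      rw [inner_smul_right, ← totalDiff_eq_inner]
      by_cases ha : ∀ i, k ≤ (a i : ℕ)
      · rw [totalDiff_atom n k hk a b ha hb, if_neg hab.symm, mul_zero]
      · rw [totalDiff_of_lt n k w a ha, zero_mul]
    · simp
  · rw [totalDiff_of_lt n k _ b hb, totalDiff_of_lt n k _ b hb]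

theorem rowPart_mem (n : ι → ℕ) (k : ℕ) (w : Tensor n) : rowPart n k w ∈ rowSpace n k := by
  refine Submodule.sum_mem _ fun a _ => ?_
  by_cases ha : ∀ i, k ≤ (a i : ℕ)
  · exact Submodule.smul_mem _ _ (Submodule.subset_span ⟨a, ha, rfl⟩)
  · rw [totalDiff_of_lt n k w a ha, zero_smul]
    exact Submodule.zero_mem _

/-- Each atom expands in tensor difference rows with Gram coefficients, so both sides are the same
sum of total differences of `w` against that Gram matrix. With `rowPart_mem`, this says that
`rowPart` is the orthogonal projection onto the row space. -/
theorem inner_rowPart (n : ι → ℕ) (k : ℕ) (hk : 1 ≤ k) (w r : Tensor n) (hr : r ∈ rowSpace n k) :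
    inner ℝ w r = inner ℝ (rowPart n k w) r := by
  induction hr using Submodule.span_induction with
  | mem x hx =>
    obtain ⟨κ, hκ, rfl⟩ := hx
    have h1 : atom n k κ = ∑ f : Idx n, inner ℝ (atom n k f) (atom n k κ) •
        pureTensor n fun i => diffVec (n i) k (f i) := by
      have h2 : (fun i => dict (n i) k (κ i)) = fun i => ∑ j : Fin (n i),
          inner ℝ (dict (n i) k j) (dict (n i) k (κ i)) • diffVec (n i) k j :=
        funext fun i => dict_eq_sum_diffVec (n i) k hk (κ i) (hκ i)
      conv_lhs => rw [atom_eq_pureTensor, h2, pureTensor_sum]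
      rw [Fintype.piFinset_univ]
      refine Finset.sum_congr rfl fun f _ => ?_
      rw [pureTensor_smul, atom_eq_pureTensor, atom_eq_pureTensor, inner_pureTensor]
    conv_lhs => rw [h1]
    rw [inner_sum, rowPart, sum_inner]
    refine Finset.sum_congr rfl fun f _ => ?_
    rw [inner_smul_right, real_inner_smul_left, totalDiff_eq_inner, real_inner_comm w]
    ring
  | zero => simp
  | add x y _ _ hx hy => rw [inner_add_right, inner_add_right, hx, hy]
  | smul c x _ hx => rw [inner_smul_right, inner_smul_right, hx]

theorem vitaliTV_rowPart (n : ι → ℕ) (k : ℕ) (hk : 1 ≤ k) (w : Tensor n) :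
    vitaliTV n k (rowPart n k w) = vitaliTV n k w := by
  simp only [vitaliTV, totalDiff_rowPart n k hk]

theorem vitaliTV_zero (n : ι → ℕ) (k : ℕ) : vitaliTV n k 0 = 0 := by
  simp [vitaliTV, totalDiff_eq_inner]

theorem vitaliTV_add_le (n : ι → ℕ) (k : ℕ) (v w : Tensor n) :
    vitaliTV n k (v + w) ≤ vitaliTV n k v + vitaliTV n k w := by
  rw [vitaliTV, vitaliTV, vitaliTV, ← Finset.sum_add_distrib]
  refine Finset.sum_le_sum fun a _ => ?_
  rw [totalDiff_add]
  exact abs_add_le _ _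

theorem vitaliTV_smul (n : ι → ℕ) (k : ℕ) (c : ℝ) (w : Tensor n) :
    vitaliTV n k (c • w) = |c| * vitaliTV n k w := by
  simp only [vitaliTV, totalDiff_smul, abs_mul, Finset.mul_sum]

theorem vitaliTV_sub_le (n : ι → ℕ) (k : ℕ) (v w : Tensor n) :
    vitaliTV n k (v - w) ≤ vitaliTV n k v + vitaliTV n k w := by
  have h := vitaliTV_add_le n k v ((-1 : ℝ) • w)
  rwa [vitaliTV_smul, abs_neg, abs_one, one_mul, neg_one_smul, ← sub_eq_add_neg] at h

/-- Trend filtering of data in the row space produces an estimator in the row space. -/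
theorem mem_rowSpace_of_isMinOn (n : ι → ℕ) (hn : ∀ i, 0 < n i) (k : ℕ) (hk : 1 ≤ k) (lam : ℝ)
    (y g : Tensor n) (hy : y ∈ rowSpace n k) (hg : IsMinOn (tfObjective n k lam y) Set.univ g) :
    g ∈ rowSpace n k := by
  -- The projected competitor has the same variation, and by Pythagoras a strictly better fit unless
  -- it equals `g`.
  have h1 := isMinOn_iff.mp hg (rowPart n k g) (Set.mem_univ _)
  have hN : (0 : ℝ) < ((∏ i, n i : ℕ) : ℝ) := by exact_mod_cast Finset.prod_pos fun i _ => hn i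
  rw [tfObjective, tfObjective, vitaliTV_rowPart n k hk, add_le_add_iff_right,
    div_le_div_iff_of_pos_right hN] at h1
  have h2 := inner_rowPart n k hk g (y - rowPart n k g)
    (Submodule.sub_mem _ hy (rowPart_mem n k g))
  have h3 : ‖y - g‖ ^ 2 = ‖y - rowPart n k g‖ ^ 2 + ‖g - rowPart n k g‖ ^ 2 := by
    have h4 : y - g = (y - rowPart n k g) - (g - rowPart n k g) := by abel
    rw [h4, norm_sub_sq_real, real_inner_comm, inner_sub_left, h2, sub_self]
    ring
  have h5 : ‖g - rowPart n k g‖ ^ 2 ≤ 0 := by linarith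
  have h6 : g - rowPart n k g = 0 := by
    rw [← norm_eq_zero]
    exact pow_eq_zero_iff two_ne_zero |>.mp (le_antisymm h5 (sq_nonneg _))
  rw [sub_eq_zero.mp h6]
  exact rowPart_mem n k g

/-- First-order optimality of the trend filtering estimator against an arbitrary competitor. -/
theorem isMinOn_tfObjective_variational (n : ι → ℕ) (hn : ∀ i, 0 < n i) (k : ℕ) (lam : ℝ)
    (hlam : 0 ≤ lam) (y ghat g : Tensor n)
    (hg : IsMinOn (tfObjective n k lam y) Set.univ ghat) :
    inner ℝ (y - ghat) (g - ghat) ≤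
      ((∏ i, n i : ℕ) : ℝ) * lam * (vitaliTV n k g - vitaliTV n k ghat) := by
  have hN : (0 : ℝ) < ((∏ i, n i : ℕ) : ℝ) := by exact_mod_cast Finset.prod_pos fun i _ => hn i
  set N : ℝ := ((∏ i, n i : ℕ) : ℝ) with hNdef
  -- Minimality is compared along the segment towards `g`, using convexity of the variation and
  -- dividing by `t`.
  have key : ∀ t : ℝ, 0 < t → t ≤ 1 → 2 * inner ℝ (y - ghat) (g - ghat) ≤
      t * ‖g - ghat‖ ^ 2 + 2 * (N * lam * (vitaliTV n k g - vitaliTV n k ghat)) := by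
    intro t ht0 ht1
    have h1 := isMinOn_iff.mp hg (ghat + t • (g - ghat)) (Set.mem_univ _)
    have h2 : vitaliTV n k (ghat + t • (g - ghat)) ≤
        (1 - t) * vitaliTV n k ghat + t * vitaliTV n k g := by
      have : ghat + t • (g - ghat) = (1 - t) • ghat + t • g := by module
      rw [this]
      refine (vitaliTV_add_le n k _ _).trans_eq ?_
      rw [vitaliTV_smul, vitaliTV_smul, abs_of_nonneg (by linarith), abs_of_pos ht0]
    have h3 : ‖y - (ghat + t • (g - ghat))‖ ^ 2 = ‖y - ghat‖ ^ 2 -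
        2 * (t * inner ℝ (y - ghat) (g - ghat)) + t ^ 2 * ‖g - ghat‖ ^ 2 := by
      rw [← sub_sub, norm_sub_sq_real, inner_smul_right, norm_smul, mul_pow, Real.norm_eq_abs,
        sq_abs]
    rw [tfObjective, tfObjective, h3, ← hNdef] at h1
    have h4 := mul_le_mul_of_nonneg_left h2 (by positivity : 0 ≤ 2 * lam)
    have h5 : ‖y - ghat‖ ^ 2 / N ≤ (‖y - ghat‖ ^ 2 -
        2 * (t * inner ℝ (y - ghat) (g - ghat)) + t ^ 2 * ‖g - ghat‖ ^ 2) / N +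
        2 * lam * (t * (vitaliTV n k g - vitaliTV n k ghat)) := by linarith
    rw [div_add' _ _ _ hN.ne', div_le_div_iff_of_pos_right hN] at h5
    refine le_of_mul_le_mul_left ?_ ht0
    linarith
  by_contra hcon
  push Not at hcon
  set δ : ℝ := inner ℝ (y - ghat) (g - ghat) -
    N * lam * (vitaliTV n k g - vitaliTV n k ghat) with hδ
  have hδ0 : 0 < δ := by linarith
  have hQ : 0 < ‖g - ghat‖ ^ 2 + δ := by positivity
  -- This `t` makes the quadratic remainder at most `δ`, whereas a violation by `δ` would require at
  -- least `2δ`.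
  have h1 := key (δ / (‖g - ghat‖ ^ 2 + δ)) (by positivity)
    ((div_le_one hQ).mpr (by linarith [sq_nonneg ‖g - ghat‖]))
  have h2 : δ / (‖g - ghat‖ ^ 2 + δ) * ‖g - ghat‖ ^ 2 ≤ δ := by
    rw [div_mul_eq_mul_div, div_le_iff₀ hQ]
    nlinarith
  linarith

end RowSpace

/-! ### The orthogonal ANOVA decomposition. -/

section Margins

variable {ι : Type*} [Fintype ι] [DecidableEq ι]

/-- `embed` as a linear map. -/
def embedLinear (n : ι → ℕ) (k : ℕ) (M : Finset ι) (h : Label k M) :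
    Tensor (subShape n M) →ₗ[ℝ] Tensor n where
  toFun := embed n k M h
  map_add' g g' := by ext j; simp [embed, add_mul]
  map_smul' c g := by ext j; simp [embed, mul_assoc]

theorem embedLinear_apply (n : ι → ℕ) (k : ℕ) (M : Finset ι) (h : Label k M)
    (g : Tensor (subShape n M)) : embedLinear n k M h g = embed n k M h g := rfl

theorem sum_sq_dict (n k j : ℕ) (hj : j < k) (hk : k ≤ n) : ∑ t, dict n k j t ^ 2 = (n : ℝ) := by
  have h := norm_dict n k j hj (by omega)
  rw [← EuclideanSpace.real_norm_sq_eq, h, Real.sq_sqrt (by positivity)]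

/-- The sum factorises over `M` and its complement, and each normalised polynomial factor off `M`
contributes its squared norm `n i`. Up to scaling, `embed` is thus an isometry. -/
theorem inner_embed (n : ι → ℕ) (k : ℕ) (hn : ∀ i, k ≤ n i) (M : Finset ι) (h : Label k M)
    (g g' : Tensor (subShape n M)) :
    inner ℝ (embed n k M h g) (embed n k M h g') =
      ((∏ i : {i // i ∉ M}, n i : ℕ) : ℝ) * inner ℝ g g' := by
  simp only [PiLp.inner_apply, RCLike.inner_apply, conj_trivial, embed]
  rw [Fintype.sum_equiv (Equiv.piEquivPiSubtypeProd (fun i => i ∈ M) fun i => Fin (n i)) _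
    (fun p => g' p.1 * g p.1 * ∏ i : {i // i ∉ M}, dict (n i) k (h i) (p.2 i) ^ 2)]
  · have hB : ∑ b : ∀ i : {i // i ∉ M}, Fin (n i),
        ∏ i : {i // i ∉ M}, dict (n i) k (h i) (b i) ^ 2 =
          ((∏ i : {i // i ∉ M}, n i : ℕ) : ℝ) := by
      rw [← Fintype.prod_sum (fun (i : {i // i ∉ M}) t => dict (n i) k (h i) t ^ 2)]
      simp only [fun i : {i // i ∉ M} => sum_sq_dict (n i) k (h i) (h i).isLt (hn i)]
      push_cast
      rfl
    rw [Fintype.sum_prod_type]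
    simp only [← Finset.mul_sum]
    refine (Finset.sum_congr rfl fun x _ => congrArg _ hB).trans ?_
    rw [← Finset.sum_mul, mul_comm]
  · intro j
    simp only [Equiv.piEquivPiSubtypeProd, Equiv.coe_fn_mk, Finset.prod_pow]
    ring

theorem norm_embed_sq (n : ι → ℕ) (k : ℕ) (hn : ∀ i, k ≤ n i) (M : Finset ι) (h : Label k M)
    (g : Tensor (subShape n M)) :
    ‖embed n k M h g‖ ^ 2 = ((∏ i : {i // i ∉ M}, n i : ℕ) : ℝ) * ‖g‖ ^ 2 := by
  rw [← real_inner_self_eq_norm_sq, inner_embed n k hn, real_inner_self_eq_norm_sq]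

/-- The dictionary multi-index with coordinates `a` on `M` and `h` off `M`. -/
def labelIdx (n : ι → ℕ) (k : ℕ) (hn : ∀ i, k ≤ n i) (M : Finset ι) (h : Label k M)
    (a : Idx (subShape n M)) : Idx n :=
  glue a fun i => ⟨h i, lt_of_lt_of_le (h i).isLt (hn i)⟩

theorem labelIdx_mem (n : ι → ℕ) (k : ℕ) (hn : ∀ i, k ≤ n i) (M : Finset ι) (h : Label k M)
    (a : Idx (subShape n M)) (i : {i // i ∈ M}) : labelIdx n k hn M h a i = a i := by
  simp [labelIdx, glue, i.2]

theorem labelIdx_notMem (n : ι → ℕ) (k : ℕ) (hn : ∀ i, k ≤ n i) (M : Finset ι) (h : Label k M)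
    (a : Idx (subShape n M)) (i : {i // i ∉ M}) :
    (labelIdx n k hn M h a i : ℕ) = h i := by
  simp [labelIdx, glue, i.2]

theorem embed_atom (n : ι → ℕ) (k : ℕ) (hn : ∀ i, k ≤ n i) (M : Finset ι) (h : Label k M)
    (a : Idx (subShape n M)) :
    embed n k M h (atom (subShape n M) k a) = atom n k (labelIdx n k hn M h a) := by
  ext j
  simp only [atom, embed]
  rw [← Fintype.prod_subtype_mul_prod_subtype (fun i => i ∈ M)]
  congr 1
  · refine Finset.prod_congr (by ext; simp) fun i _ => ?_
    rw [labelIdx_mem]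
  · exact Finset.prod_congr rfl fun i _ => by rw [labelIdx_notMem]

/-- Reduces a margin to the row space of a tensor of lower dimension, so that the results on trend
filtering apply with shape `subShape n M`. -/
theorem marginSpace_eq_map (n : ι → ℕ) (k : ℕ) (hn : ∀ i, k ≤ n i) (M : Finset ι)
    (h : Label k M) :
    marginSpace n k M h = (rowSpace (subShape n M) k).map (embedLinear n k M h) := by
  rw [rowSpace, Submodule.map_span, marginSpace]
  congr 1
  ext x
  constructor
  · rintro ⟨κ, ⟨hκ, hκ'⟩, rfl⟩
    refine ⟨_, ⟨fun i => κ i, fun i => hκ i i.2, rfl⟩, ?_⟩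
    rw [embedLinear_apply, embed_atom n k hn]
    congr 1
    funext i
    by_cases hi : i ∈ M
    · exact labelIdx_mem n k hn M h _ ⟨i, hi⟩
    · exact Fin.ext ((labelIdx_notMem n k hn M h _ ⟨i, hi⟩).trans (hκ' ⟨i, hi⟩).symm)
  · rintro ⟨_, ⟨a, ha, rfl⟩, rfl⟩
    refine ⟨labelIdx n k hn M h a, ⟨fun i hi => ?_, fun i => labelIdx_notMem n k hn M h a i⟩, ?_⟩
    · rw [labelIdx_mem n k hn M h a ⟨i, hi⟩]
      exact ha ⟨i, hi⟩
    · exact (embed_atom n k hn M h a).symm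

theorem embed_mem_marginSpace (n : ι → ℕ) (k : ℕ) (hn : ∀ i, k ≤ n i) (M : Finset ι)
    (h : Label k M) (g : Tensor (subShape n M)) (hg : g ∈ rowSpace (subShape n M) k) :
    embed n k M h g ∈ marginSpace n k M h := by
  rw [marginSpace_eq_map n k hn]
  exact Submodule.mem_map_of_mem hg

theorem embed_injective (n : ι → ℕ) (k : ℕ) (hn : ∀ i, k ≤ n i) (hn' : ∀ i, 0 < n i)
    (M : Finset ι) (h : Label k M) : Function.Injective (embed n k M h) := by
  intro g g' hgg
  have h1 : embedLinear n k M h (g - g') = 0 := by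
    rw [map_sub, sub_eq_zero]
    exact hgg
  have h2 := norm_embed_sq n k hn M h (g - g')
  rw [← embedLinear_apply, h1, norm_zero, zero_pow two_ne_zero] at h2
  have h3 : ((∏ i : {i // i ∉ M}, n i : ℕ) : ℝ) ≠ 0 := by
    exact_mod_cast (Finset.prod_pos fun (i : {i // i ∉ M}) _ => hn' i).ne'
  rw [← sub_eq_zero, ← norm_eq_zero]
  rcases mul_eq_zero.mp h2.symm with h4 | h4
  · exact absurd h4 h3
  · exact pow_eq_zero_iff two_ne_zero |>.mp h4

theorem marginCoef_mem_rowSpace (n : ι → ℕ) (k : ℕ) (hn : ∀ i, k ≤ n i) (hn' : ∀ i, 0 < n i)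
    (M : Finset ι) (h : Label k M) (f : Tensor n) :
    marginCoef n k M h f ∈ rowSpace (subShape n M) k := by
  have h1 : margin n k M h f ∈ marginSpace n k M h := Submodule.starProjection_apply_mem _ _
  rw [marginSpace_eq_map n k hn] at h1
  obtain ⟨g, hg, hgf⟩ := h1
  rw [← embed_marginCoef n k hn, embedLinear_apply] at hgf
  rwa [← embed_injective n k hn hn' M h hgf]

theorem marginCoef_add (n : ι → ℕ) (k : ℕ) (M : Finset ι) (h : Label k M) (f f' : Tensor n) :
    marginCoef n k M h (f + f') = marginCoef n k M h f + marginCoef n k M h f' := by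
  ext a
  simp [marginCoef, margin, add_mul, Finset.sum_add_distrib, mul_add]

/-- Distinct one-dimensional dictionary vectors are orthogonal as soon as one index is below `k`.
Atoms that are not orthogonal therefore share their low indices and the set of coordinates with high
index, and these determine the margin. -/
theorem label_eq_of_atom_class (n : ι → ℕ) (k : ℕ) {M M' : Finset ι} {h : Label k M}
    {h' : Label k M'} {κ κ' : Idx n}
    (hκ : (∀ i ∈ M, k ≤ (κ i : ℕ)) ∧ ∀ i : {i // i ∉ M}, (κ i : ℕ) = (h i : ℕ))
    (hκ' : (∀ i ∈ M', k ≤ (κ' i : ℕ)) ∧ ∀ i : {i // i ∉ M'}, (κ' i : ℕ) = (h' i : ℕ))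
    (hne : inner ℝ (atom n k κ) (atom n k κ') ≠ 0) :
    (⟨M, h⟩ : Σ M : Finset ι, Label k M) = ⟨M', h'⟩ := by
  have hi : ∀ i, (κ i : ℕ) = κ' i ∨ (k ≤ (κ i : ℕ) ∧ k ≤ (κ' i : ℕ)) := by
    intro i
    by_contra hcon
    push Not at hcon
    refine hne ?_
    rw [atom_eq_pureTensor, atom_eq_pureTensor, inner_pureTensor]
    refine Finset.prod_eq_zero (Finset.mem_univ i) (inner_dict_eq_zero _ _ _ _ hcon.1 ?_)
    by_contra h2
    push Not at h2
    exact absurd (hcon.2 h2.1) (by omega)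
  have hM : ∀ i, i ∈ M ↔ k ≤ (κ i : ℕ) := fun i =>
    ⟨hκ.1 i, fun hk => by
      by_contra hiM
      have := hκ.2 ⟨i, hiM⟩
      have := (h ⟨i, hiM⟩).isLt
      simp only at *
      omega⟩
  have hM' : ∀ i, i ∈ M' ↔ k ≤ (κ' i : ℕ) := fun i =>
    ⟨hκ'.1 i, fun hk => by
      by_contra hiM
      have := hκ'.2 ⟨i, hiM⟩
      have := (h' ⟨i, hiM⟩).isLt
      simp only at *
      omega⟩
  obtain rfl : M = M' := by
    ext i
    rw [hM, hM']
    have := hi i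
    omega
  congr 1
  funext i
  have h1 := hκ.2 i
  have h2 := hκ'.2 i
  have h3 := hi i
  have h4 := (h i).isLt
  exact Fin.ext (by omega)

theorem orthogonalFamily_marginSpace (n : ι → ℕ) (k : ℕ) :
    OrthogonalFamily ℝ (fun p : Σ M : Finset ι, Label k M => marginSpace n k p.1 p.2)
      fun p => (marginSpace n k p.1 p.2).subtypeₗᵢ := by
  refine OrthogonalFamily.of_pairwise fun p q hpq => ?_
  rw [Function.onFun, marginSpace, marginSpace, Submodule.isOrtho_span]
  rintro _ ⟨κ, hκ, rfl⟩ _ ⟨κ', hκ', rfl⟩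
  by_contra hne
  exact hpq (label_eq_of_atom_class n k hκ hκ' hne)

theorem atom_mem_iSup_marginSpace (n : ι → ℕ) (k : ℕ) (κ : Idx n) :
    atom n k κ ∈ ⨆ p : Σ M : Finset ι, Label k M, marginSpace n k p.1 p.2 := by
  classical
  let M : Finset ι := Finset.univ.filter fun i => k ≤ (κ i : ℕ)
  have hM : ∀ i, i ∉ M → (κ i : ℕ) < k := fun i hi => by
    simpa [M] using hi
  let h : Label k M := fun i => ⟨κ i, hM i i.2⟩
  refine Submodule.mem_iSup_of_mem (⟨M, h⟩ : Σ M : Finset ι, Label k M) ?_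
  refine Submodule.subset_span ⟨κ, ⟨fun i hi => ?_, fun i => rfl⟩, rfl⟩
  simpa [M] using hi

/-- The one-dimensional dictionary spans, so every unit tensor expands in atoms, and each atom
belongs to some margin. -/
theorem iSup_marginSpace (n : ι → ℕ) (k : ℕ) (hk : 1 ≤ k) (hn : ∀ i, k ≤ n i) :
    ⨆ p : Σ M : Finset ι, Label k M, marginSpace n k p.1 p.2 = ⊤ := by
  rw [eq_top_iff]
  intro f _
  have hsingle : ∀ j : Idx n, pureTensor n (fun i => EuclideanSpace.single (j i) (1 : ℝ)) ∈
      ⨆ p : Σ M : Finset ι, Label k M, marginSpace n k p.1 p.2 := by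
    intro j
    have h1 : ∀ i, ∃ c : Fin (n i) → ℝ,
        ∑ a, c a • dict (n i) k a = EuclideanSpace.single (j i) (1 : ℝ) := fun i => by
      have : EuclideanSpace.single (j i) (1 : ℝ) ∈
          Submodule.span ℝ (Set.range fun a : Fin (n i) => dict (n i) k a) := by
        rw [span_dict_eq_top (n i) k hk (hn i)]
        exact Submodule.mem_top
      exact (Submodule.mem_span_range_iff_exists_fun ℝ).mp this
    choose c hc using h1
    rw [← funext hc, pureTensor_sum]
    refine Submodule.sum_mem _ fun κ _ => ?_
    rw [pureTensor_smul]
    exact Submodule.smul_mem _ _ (atom_mem_iSup_marginSpace n k κ)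
  have hf : f = ∑ j : Idx n, f j • pureTensor n
      (fun i => EuclideanSpace.single (j i) (1 : ℝ)) := by
    ext s
    rw [WithLp.ofLp_sum, Finset.sum_apply, Finset.sum_eq_single s]
    · simp [pureTensor]
    · intro b _ hb
      obtain ⟨i, hi⟩ := Function.ne_iff.mp hb
      simp only [PiLp.smul_apply, pureTensor, smul_eq_mul]
      rw [Finset.prod_eq_zero (Finset.mem_univ i) (by simp [hi.symm]), mul_zero]
    · simp
  rw [hf]
  exact Submodule.sum_mem _ fun j _ => Submodule.smul_mem _ _ (hsingle j)

/-- The ANOVA decomposition. -/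
theorem sum_margin (n : ι → ℕ) (k : ℕ) (hk : 1 ≤ k) (hn : ∀ i, k ≤ n i) (f : Tensor n) :
    ∑ M : Finset ι, ∑ h : Label k M, margin n k M h f = f := by
  rw [← Fintype.sum_sigma' (fun (M : Finset ι) (h : Label k M) => margin n k M h f)]
  exact (orthogonalFamily_marginSpace n k).sum_projection_of_mem_iSup f
    (by rw [iSup_marginSpace n k hk hn]; exact Submodule.mem_top)

theorem norm_sum_marginSpace_sq (n : ι → ℕ) (k : ℕ)
    (x : ∀ M : Finset ι, Label k M → Tensor n)
    (hx : ∀ M h, x M h ∈ marginSpace n k M h) :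
    ‖∑ M : Finset ι, ∑ h : Label k M, x M h‖ ^ 2 =
      ∑ M : Finset ι, ∑ h : Label k M, ‖x M h‖ ^ 2 := by
  rw [← Fintype.sum_sigma' (fun (M : Finset ι) (h : Label k M) => x M h),
    ← Fintype.sum_sigma' (fun (M : Finset ι) (h : Label k M) => ‖x M h‖ ^ 2)]
  exact (orthogonalFamily_marginSpace n k).norm_sum
    (fun p => (⟨x p.1 p.2, hx p.1 p.2⟩ : marginSpace n k p.1 p.2)) Finset.univ

end Margins

/-! ### Selection of scales and approximation of atoms. -/

section HyperbolicCross

/-- The box `{0, …, T - 1}^d` of scales. -/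
def scaleBox (d T : ℕ) : Finset (Fin d → ℕ) := Fintype.piFinset fun _ => Finset.range T

/-- The sum is a product of `d` geometric sums. The bound does not depend on the number `T` of
scales. -/
theorem sum_scaleBox_pow_le (d T : ℕ) (θ : ℝ) (h0 : 0 ≤ θ) (h1 : θ < 1) :
    ∑ l ∈ scaleBox d T, θ ^ (∑ i, l i) ≤ ((1 - θ)⁻¹) ^ d := by
  have h2 : ∀ l ∈ scaleBox d T, θ ^ (∑ i, l i) = ∏ i, θ ^ l i := fun l _ =>
    (Finset.prod_pow_eq_pow_sum _ _ _).symm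
  rw [Finset.sum_congr rfl h2, scaleBox, ← Finset.prod_univ_sum (fun _ => Finset.range T)
    fun _ a => θ ^ a, Finset.prod_const, Finset.card_univ, Fintype.card_fin]
  refine pow_le_pow_left₀ (Finset.sum_nonneg fun _ _ => pow_nonneg h0 _) ?_ d
  rw [← tsum_geometric_of_lt_one h0 h1]
  exact (summable_geometric_of_lt_one h0 h1).sum_le_tsum _ fun _ _ => pow_nonneg h0 _

theorem sum_filter_scaleBox_one (T : ℕ) (p : ℕ → Prop) [DecidablePred p] (F : ℕ → ℝ) :
    ∑ l ∈ (scaleBox 1 T).filter (fun l => p (∑ i, l i)), F (∑ i, l i) =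
      ∑ a ∈ (Finset.range T).filter p, F a := by
  refine Finset.sum_nbij' (fun l => l 0) (fun a _ => a) ?_ ?_ ?_ ?_ ?_
  · intro l hl
    simpa [scaleBox] using hl
  · intro a ha
    simpa [scaleBox] using ha
  · intro l _
    funext i
    rw [Subsingleton.elim i 0]
  · intro a _
    rfl
  · intro l _
    simp

theorem harmonic_one_le (d : ℕ) (hd : 1 ≤ d) : (1 : ℝ) ≤ ((harmonic d : ℚ) : ℝ) := by
  induction d, hd using Nat.le_induction with
  | base => simp [harmonic]
  | succ d _ ih =>
    rw [harmonic_succ]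
    push_cast
    have : (0 : ℝ) ≤ ((d : ℝ) + 1)⁻¹ := by positivity
    linarith

/-- The only fact about H(d) needed for `d ≥ 2` in choosing scales: the target exponent `x / H(d)`
is at most `2x/3`, strictly below `x`. -/
theorem three_halves_le_harmonic (d : ℕ) (hd : 2 ≤ d) :
    (3 / 2 : ℝ) ≤ ((harmonic d : ℚ) : ℝ) := by
  induction d, hd using Nat.le_induction with
  | base => norm_num [harmonic, Finset.sum_range_succ]
  | succ d _ ih =>
    rw [harmonic_succ]
    push_cast
    have : (0 : ℝ) ≤ ((d : ℝ) + 1)⁻¹ := by positivity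
    linarith

/-- Hyperbolic sets of scales: the total dimension is of order `s` and the total error at the
remaining scales is of order `s^{-(2k-1)/(2H(d))}`. -/
theorem exists_scales (d k : ℕ) (hd : 1 ≤ d) (hk : 1 ≤ k) : ∃ C : ℝ, 0 < C ∧
    ∀ (T : ℕ) (s : ℝ), 1 ≤ s → ∃ Λ ⊆ scaleBox d T,
      ∑ l ∈ Λ, (2 : ℝ) ^ (∑ i, l i) ≤ C * s ∧
      ∑ l ∈ scaleBox d T \ Λ, decay k ^ (∑ i, l i) ≤
        C * s ^ (-((2 * k - 1) / (2 * ((harmonic d : ℚ) : ℝ)))) := by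
  have hk' : (1 : ℝ) ≤ k := by exact_mod_cast hk
  set x : ℝ := (2 * k - 1) / 2 with hx
  have hx0 : 0 < x := by rw [hx]; linarith
  have hρ0 := decay_pos k
  have hρ : decay k = (2 : ℝ) ^ (-x) := rfl
  have hρ1 : decay k < 1 := by
    rw [hρ]
    exact Real.rpow_lt_one_of_one_lt_of_neg one_lt_two (by linarith)
  have hpow : ∀ (y : ℝ) (a : ℕ), ((2 : ℝ) ^ y) ^ a = 2 ^ (y * a) := fun y a => by
    rw [Real.rpow_mul zero_le_two, Real.rpow_natCast]
  have hexp : ((2 * k - 1) / (2 * ((harmonic d : ℚ) : ℝ)) : ℝ) =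
      x / ((harmonic d : ℚ) : ℝ) := by
    rw [hx, div_div]
  rw [hexp]
  -- For `d = 1` there is no slack in the exponent, but there is one scale for each total: the
  -- cutoff is at `2^L ≤ s < 2^(L+1)`, and both sums are geometric.
  rcases hd.eq_or_lt with rfl | hd2
  · have hH : ((harmonic 1 : ℚ) : ℝ) = 1 := by simp [harmonic]
    refine ⟨2 + (1 - decay k)⁻¹, by have := sub_pos.mpr hρ1; positivity, fun T s hs => ?_⟩
    have h1ρ : 0 < (1 - decay k)⁻¹ := inv_pos.mpr (sub_pos.mpr hρ1)
    have hs0 : (0 : ℝ) < s := by linarith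
    have hfl : ⌊s⌋₊ ≠ 0 := (Nat.floor_pos.mpr hs).ne'
    set L := Nat.log 2 ⌊s⌋₊ with hL
    have hL1 : (2 : ℝ) ^ L ≤ s := by
      have h1 := Nat.pow_log_le_self 2 hfl
      exact le_trans (by exact_mod_cast h1) (Nat.floor_le hs0.le)
    have hL2 : s < (2 : ℝ) ^ (L + 1) := by
      have h1 := Nat.lt_pow_succ_log_self one_lt_two ⌊s⌋₊
      have h2 := Nat.lt_floor_add_one s
      have h3 : ((⌊s⌋₊ + 1 : ℕ) : ℝ) ≤ ((2 ^ (L + 1) : ℕ) : ℝ) := by exact_mod_cast h1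
      push_cast at h3
      linarith
    refine ⟨(scaleBox 1 T).filter fun l => (∑ i, l i) ≤ L, Finset.filter_subset _ _, ?_, ?_⟩
    · rw [sum_filter_scaleBox_one T (fun a => a ≤ L) fun a => (2 : ℝ) ^ a]
      have h1 : ∑ a ∈ (Finset.range T).filter (fun a => a ≤ L), (2 : ℝ) ^ a ≤
          ∑ a ∈ Finset.range (L + 1), (2 : ℝ) ^ a := by
        refine Finset.sum_le_sum_of_subset_of_nonneg (fun a ha => ?_) fun _ _ _ => by positivity
        simp only [Finset.mem_filter, Finset.mem_range] at ha ⊢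
        omega
      have h2 : ∑ a ∈ Finset.range (L + 1), (2 : ℝ) ^ a = 2 ^ (L + 1) - 1 := by
        rw [geom_sum_eq (by norm_num)]
        norm_num
      rw [h2, pow_succ] at h1
      nlinarith
    · rw [← Finset.filter_not, sum_filter_scaleBox_one T (fun a => ¬ a ≤ L) fun a => decay k ^ a,
        hH,
        div_one]
      have h1 : ∑ a ∈ (Finset.range T).filter (fun a => ¬ a ≤ L), decay k ^ a ≤
          ∑ a ∈ Finset.range T, decay k ^ (L + 1) * decay k ^ a := by
        have h2 : ∀ a ∈ (Finset.range T).filter (fun a => ¬ a ≤ L),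
            decay k ^ a = decay k ^ (L + 1) * decay k ^ (a - (L + 1)) := by
          intro a ha
          rw [Finset.mem_filter] at ha
          rw [← pow_add]
          congr 1
          omega
        rw [Finset.sum_congr rfl h2]
        rw [← Finset.sum_image (f := fun b => decay k ^ (L + 1) * decay k ^ b)
          (g := fun a => a - (L + 1)) (s := (Finset.range T).filter (fun a => ¬ a ≤ L))]
        · refine Finset.sum_le_sum_of_subset_of_nonneg (fun a ha => ?_) fun _ _ _ => by positivity
          simp only [Finset.mem_image, Finset.mem_filter, Finset.mem_range] at ha ⊢
          omega
        · intro a ha b hb hab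
          simp only [Finset.coe_filter, Finset.mem_range, Set.mem_ofPred_eq] at ha hb
          simp only at hab
          omega
      rw [← Finset.mul_sum] at h1
      have h3 : ∑ a ∈ Finset.range T, decay k ^ a ≤ (1 - decay k)⁻¹ := by
        rw [← tsum_geometric_of_lt_one hρ0.le hρ1]
        exact (summable_geometric_of_lt_one hρ0.le hρ1).sum_le_tsum _ fun _ _ => by positivity
      have h4 : decay k ^ (L + 1) ≤ s ^ (-x) := by
        rw [hρ, hpow, mul_comm, Real.rpow_mul zero_le_two, Real.rpow_natCast]
        exact Real.rpow_le_rpow_of_nonpos hs0 hL2.le (by linarith)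
      have h5 : 0 < s ^ (-x) := Real.rpow_pos_of_pos hs0 _
      calc _ ≤ decay k ^ (L + 1) * ∑ a ∈ Finset.range T, decay k ^ a := h1
        _ ≤ s ^ (-x) * (1 - decay k)⁻¹ := mul_le_mul h4 h3
            (Finset.sum_nonneg fun _ _ => by positivity) h5.le
        _ ≤ (2 + (1 - decay k)⁻¹) * s ^ (-x) := by nlinarith
  -- The threshold `β^|l| ≤ s` splits both weights: `2 = β θ` and `decay k = β^(-2x/3) η`. The `β`
  -- factors give the powers of `s`; `θ, η < 1` make the remaining sums converge.
  · set β : ℝ := 2 ^ (6 / 5 : ℝ) with hβ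
    set θ : ℝ := 2 ^ (-(1 / 5) : ℝ) with hθ
    set η : ℝ := 2 ^ (-(x / 5) : ℝ) with hη
    have hβ0 : 0 < β := Real.rpow_pos_of_pos two_pos _
    have hθ0 : 0 < θ := Real.rpow_pos_of_pos two_pos _
    have hη0 : 0 < η := Real.rpow_pos_of_pos two_pos _
    have hθ1 : θ < 1 := Real.rpow_lt_one_of_one_lt_of_neg one_lt_two (by norm_num)
    have hη1 : η < 1 := Real.rpow_lt_one_of_one_lt_of_neg one_lt_two (by linarith)
    have hCθ : 0 < ((1 - θ)⁻¹) ^ d := pow_pos (inv_pos.mpr (sub_pos.mpr hθ1)) _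
    have hCη : 0 < ((1 - η)⁻¹) ^ d := pow_pos (inv_pos.mpr (sub_pos.mpr hη1)) _
    refine ⟨((1 - θ)⁻¹) ^ d + ((1 - η)⁻¹) ^ d, by positivity, fun T s hs => ?_⟩
    have hs0 : (0 : ℝ) < s := by linarith
    refine ⟨(scaleBox d T).filter fun l => β ^ (∑ i, l i) ≤ s, Finset.filter_subset _ _, ?_, ?_⟩
    · have h1 : ∀ l ∈ (scaleBox d T).filter (fun l => β ^ (∑ i, l i) ≤ s),
          (2 : ℝ) ^ (∑ i, l i) ≤ s * θ ^ (∑ i, l i) := by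
        intro l hl
        rw [Finset.mem_filter] at hl
        have h2 : (2 : ℝ) = β * θ := by
          rw [hβ, hθ, ← Real.rpow_add two_pos]
          norm_num
        calc (2 : ℝ) ^ (∑ i, l i) = β ^ (∑ i, l i) * θ ^ (∑ i, l i) := by rw [← mul_pow, ← h2]
          _ ≤ _ := mul_le_mul_of_nonneg_right hl.2 (by positivity)
      have h3 := sum_scaleBox_pow_le d T θ hθ0.le hθ1
      calc _ ≤ ∑ l ∈ (scaleBox d T).filter (fun l => β ^ (∑ i, l i) ≤ s),
            s * θ ^ (∑ i, l i) := Finset.sum_le_sum h1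
        _ ≤ ∑ l ∈ scaleBox d T, s * θ ^ (∑ i, l i) :=
            Finset.sum_le_sum_of_subset_of_nonneg (Finset.filter_subset _ _)
              fun _ _ _ => by positivity
        _ = s * ∑ l ∈ scaleBox d T, θ ^ (∑ i, l i) := by rw [Finset.mul_sum]
        _ ≤ s * ((1 - θ)⁻¹) ^ d := mul_le_mul_of_nonneg_left h3 hs0.le
        _ ≤ _ := by nlinarith
    · rw [← Finset.filter_not]
      have hH := three_halves_le_harmonic d hd2
      have hsx : s ^ (-(2 * x / 3)) ≤ s ^ (-(x / ((harmonic d : ℚ) : ℝ))) := by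
        refine Real.rpow_le_rpow_of_exponent_le hs (neg_le_neg ?_)
        rw [div_le_div_iff₀ (by linarith) (by norm_num)]
        nlinarith
      have h1 : ∀ l ∈ (scaleBox d T).filter (fun l => ¬ β ^ (∑ i, l i) ≤ s),
          decay k ^ (∑ i, l i) ≤ s ^ (-(x / ((harmonic d : ℚ) : ℝ))) * η ^ (∑ i, l i) := by
        intro l hl
        rw [Finset.mem_filter, not_le] at hl
        have h2 : decay k = β ^ (-(2 * x / 3)) * η := by
          rw [hβ, hη, hρ, ← Real.rpow_mul zero_le_two, ← Real.rpow_add two_pos]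
          congr 1
          ring
        rw [h2, mul_pow]
        refine mul_le_mul_of_nonneg_right (le_trans ?_ hsx) (by positivity)
        rw [← Real.rpow_natCast, ← Real.rpow_mul hβ0.le, mul_comm, Real.rpow_mul hβ0.le,
          Real.rpow_natCast]
        exact Real.rpow_le_rpow_of_nonpos hs0 hl.2.le (by linarith)
      have h3 := sum_scaleBox_pow_le d T η hη0.le hη1
      set S := s ^ (-(x / ((harmonic d : ℚ) : ℝ))) with hS
      have hS0 : 0 < S := Real.rpow_pos_of_pos hs0 _
      calc _ ≤ ∑ l ∈ (scaleBox d T).filter (fun l => ¬ β ^ (∑ i, l i) ≤ s),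
            S * η ^ (∑ i, l i) := Finset.sum_le_sum h1
        _ ≤ ∑ l ∈ scaleBox d T, S * η ^ (∑ i, l i) :=
            Finset.sum_le_sum_of_subset_of_nonneg (Finset.filter_subset _ _)
              fun _ _ _ => by positivity
        _ = S * ∑ l ∈ scaleBox d T, η ^ (∑ i, l i) := by rw [Finset.mul_sum]
        _ ≤ S * ((1 - η)⁻¹) ^ d := mul_le_mul_of_nonneg_left h3 hS0.le
        _ ≤ _ := by nlinarith

/-- The span of the outer products of vectors from `W i (l i)`, over the scales `l ∈ Λ`. -/
theorem exists_submodule_pureTensor {d : ℕ} (n : Fin d → ℕ)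
    (W : ∀ i, ℕ → Submodule ℝ (EuclideanSpace ℝ (Fin (n i)))) (C : ℝ)
    (hW : ∀ i l, (Module.finrank ℝ (W i l) : ℝ) ≤ C * 2 ^ l) (Λ : Finset (Fin d → ℕ)) :
    ∃ V : Submodule ℝ (Tensor n),
      (Module.finrank ℝ V : ℝ) ≤ C ^ d * ∑ l ∈ Λ, (2 : ℝ) ^ (∑ i, l i) ∧
      ∀ l ∈ Λ, ∀ w : ∀ i, EuclideanSpace ℝ (Fin (n i)), (∀ i, w i ∈ W i (l i)) →
        pureTensor n w ∈ V := by
  let b := fun i l => Module.finBasis ℝ (W i l)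
  let F : (Σ l : Λ, ∀ i, Fin (Module.finrank ℝ (W i (l.1 i)))) → Tensor n := fun p =>
    pureTensor n fun i => (b i (p.1.1 i) (p.2 i) : EuclideanSpace ℝ (Fin (n i)))
  refine ⟨Submodule.span ℝ (Set.range F), ?_, fun l hl w hw => ?_⟩
  · have h1 : Module.finrank ℝ (Submodule.span ℝ (Set.range F)) ≤ _ := finrank_range_le_card F
    rw [Fintype.card_sigma] at h1
    simp only [Fintype.card_pi, Fintype.card_fin] at h1
    rw [Finset.sum_coe_sort Λ fun l => ∏ i, Module.finrank ℝ (W i (l i))] at h1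
    calc (Module.finrank ℝ (Submodule.span ℝ (Set.range F)) : ℝ)
        ≤ ((∑ l ∈ Λ, ∏ i, Module.finrank ℝ (W i (l i)) : ℕ) : ℝ) := by exact_mod_cast h1
      _ = ∑ l ∈ Λ, ∏ i, (Module.finrank ℝ (W i (l i)) : ℝ) := by push_cast; rfl
      _ ≤ ∑ l ∈ Λ, C ^ d * (2 : ℝ) ^ (∑ i, l i) := by
          refine Finset.sum_le_sum fun l _ => ?_
          refine (Finset.prod_le_prod (fun _ _ => by positivity) fun i _ => hW i (l i)).trans_eq ?_
          rw [Finset.prod_mul_distrib, Finset.prod_const, Finset.card_univ, Fintype.card_fin,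
            Finset.prod_pow_eq_pow_sum]
      _ = _ := by rw [Finset.mul_sum]
  · have h1 : ∀ i, w i = ∑ r, (b i (l i)).repr ⟨w i, hw i⟩ r •
        (b i (l i) r : EuclideanSpace ℝ (Fin (n i))) := by
      intro i
      have h2 := congrArg Subtype.val ((b i (l i)).sum_repr ⟨w i, hw i⟩)
      rw [Submodule.coe_sum] at h2
      exact h2.symm
    rw [funext h1, pureTensor_sum]
    refine Submodule.sum_mem _ fun f _ => ?_
    rw [pureTensor_smul]
    exact Submodule.smul_mem _ _ (Submodule.subset_span ⟨⟨⟨l, hl⟩, f⟩, rfl⟩)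

/-- After expanding the product of sums, the error consists of the omitted multi-scales, and the
norm of each outer product is multiplicative. -/
theorem norm_pureTensor_sub_le {d : ℕ} (n : Fin d → ℕ) (C ρ : ℝ)
    (ψ : ∀ i, ℕ → EuclideanSpace ℝ (Fin (n i)))
    (hψ : ∀ i l, ‖ψ i l‖ ≤ C * √(n i : ℝ) * ρ ^ l) (T : ℕ) (Λ : Finset (Fin d → ℕ))
    (hΛ : Λ ⊆ scaleBox d T) :
    ‖pureTensor n (fun i => ∑ l ∈ Finset.range T, ψ i l) -
        ∑ l ∈ Λ, pureTensor n fun i => ψ i (l i)‖ ≤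
      C ^ d * √((∏ i, n i : ℕ) : ℝ) * ∑ l ∈ scaleBox d T \ Λ, ρ ^ (∑ i, l i) := by
  rw [pureTensor_sum n (fun _ => Finset.range T), ← scaleBox, ← Finset.sum_sdiff hΛ,
    add_sub_cancel_right, Finset.mul_sum]
  refine (norm_sum_le _ _).trans (Finset.sum_le_sum fun l _ => ?_)
  rw [norm_pureTensor]
  refine (Finset.prod_le_prod (fun _ _ => norm_nonneg _) fun i _ => hψ i (l i)).trans_eq ?_
  rw [Finset.prod_mul_distrib, Finset.prod_mul_distrib, Finset.prod_const, Finset.card_univ,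
    Fintype.card_fin, Finset.prod_pow_eq_pow_sum]
  congr 2
  push_cast
  rw [Real.sqrt_prod _ fun i _ => Nat.cast_nonneg _]

/-- Multiscale expansion of the dictionary vectors occurring in one coordinate of a margin. -/
theorem exists_multiscale_margin (k : ℕ) (hk : 1 ≤ k) : ∃ C : ℝ, 1 ≤ C ∧
    ∀ {d : ℕ} (n : Fin d → ℕ) (_ : ∀ i, k ≤ n i) (M : Finset (Fin d)) (h : Label k M) (i : Fin d),
    ∃ W : ℕ → Submodule ℝ (EuclideanSpace ℝ (Fin (n i))),
      (∀ l, (Module.finrank ℝ (W l) : ℝ) ≤ C * 2 ^ l) ∧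
      ∀ j : ℕ, j < n i → (i ∈ M → k ≤ j) → (∀ hi : i ∉ M, j = h ⟨i, hi⟩) →
        ∃ ψ : ℕ → EuclideanSpace ℝ (Fin (n i)),
        (∀ l, ψ l ∈ W l) ∧ (∀ l, ‖ψ l‖ ≤ C * √(n i : ℝ) * decay k ^ l) ∧
        ∀ T, n i < T → ∑ l ∈ Finset.range T, ψ l = dict (n i) k j := by
  obtain ⟨C, hC, hms⟩ := exists_multiscale k hk
  refine ⟨C, hC, fun n hn M h i => ?_⟩
  have hρ := decay_pos k
  by_cases hi : i ∈ M
  · obtain ⟨W, hW, hψ⟩ := hms (n i)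
    exact ⟨W, hW, fun j hj hjM _ => hψ j (hjM hi) hj⟩
  -- Off `M` the vector is one fixed polynomial: a line carries it entirely at scale zero, at no
  -- cost in dimension or error.
  · set v := dict (n i) k (h ⟨i, hi⟩) with hv
    have hnorm : ‖v‖ = √(n i : ℝ) :=
      norm_dict _ _ _ (h ⟨i, hi⟩).isLt (lt_of_lt_of_le (h ⟨i, hi⟩).isLt (hn i))
    refine ⟨fun _ => Submodule.span ℝ {v}, fun l => ?_, fun j hj _ hj' =>
      ⟨fun l => if l = 0 then v else 0, fun l => ?_, fun l => ?_, fun T hT => ?_⟩⟩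
    · have h1 : (Module.finrank ℝ (Submodule.span ℝ {v}) : ℝ) ≤ 1 := by
        have := finrank_span_le_card (R := ℝ) ({v} : Set (EuclideanSpace ℝ (Fin (n i))))
        simp only [Set.toFinset_singleton, Finset.card_singleton] at this
        exact_mod_cast this
      have h2 : (1 : ℝ) ≤ 2 ^ l := one_le_pow₀ one_le_two
      nlinarith
    · dsimp only
      split_ifs
      · exact Submodule.mem_span_singleton_self v
      · exact Submodule.zero_mem _
    · dsimp only
      split_ifs with hl
      · rw [hl, pow_zero, mul_one, hnorm]
        exact le_mul_of_one_le_left (Real.sqrt_nonneg _) hC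
      · rw [norm_zero]
        positivity
    · rw [Finset.sum_ite_eq' (Finset.range T) 0 fun _ => v,
        if_pos (Finset.mem_range.mpr (by omega)), hj' hi]

/-- Approximation of the dictionary tensors of a margin from a space of dimension of order `s`. -/
theorem exists_approx_space (d k : ℕ) (hd : 1 ≤ d) (hk : 1 ≤ k) : ∃ C : ℝ, 0 < C ∧
    ∀ (n : Fin d → ℕ) (hn : ∀ i, k ≤ n i) (M : Finset (Fin d)) (h : Label k M) (s : ℝ), 1 ≤ s →
    ∃ V : Submodule ℝ (Tensor n), (Module.finrank ℝ V : ℝ) ≤ C * s ∧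
      ∀ a : Idx (subShape n M), (∀ i, k ≤ (a i : ℕ)) →
        ‖atom n k (labelIdx n k hn M h a) - V.starProjection (atom n k (labelIdx n k hn M h a))‖ ≤
          C * √((∏ i, n i : ℕ) : ℝ) * s ^ (-((2 * k - 1) / (2 * ((harmonic d : ℚ) : ℝ)))) := by
  obtain ⟨C₁, hC₁, hms⟩ := exists_multiscale_margin k hk
  obtain ⟨C₂, hC₂, hsc⟩ := exists_scales d k hd hk
  refine ⟨C₁ ^ d * C₂, by positivity, fun n hn M h s hs => ?_⟩
  choose W hW hψ using hms n hn M h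
  -- The number of scales exceeds every `n i`, so all the one-dimensional expansions are exact.
  obtain ⟨Λ, hΛ, hΛ1, hΛ2⟩ := hsc (∑ i, n i + 1) s hs
  obtain ⟨V, hV, hVmem⟩ := exists_submodule_pureTensor n W C₁ hW Λ
  refine ⟨V, hV.trans ?_, fun a ha => ?_⟩
  · rw [mul_assoc]
    exact mul_le_mul_of_nonneg_left hΛ1 (by positivity)
  set κ := labelIdx n k hn M h a with hκ
  choose ψ hψW hψn hψs using fun i => hψ i (κ i) (κ i).isLt
    (fun hi => by rw [hκ, labelIdx_mem n k hn M h a ⟨i, hi⟩]; exact ha ⟨i, hi⟩)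
    (fun hi => labelIdx_notMem n k hn M h a ⟨i, hi⟩)
  have hat : atom n k κ = pureTensor n fun i => ∑ l ∈ Finset.range (∑ i, n i + 1), ψ i l := by
    rw [atom_eq_pureTensor]
    congr 1
    funext i
    rw [hψs i]
    exact Nat.lt_succ_of_le (Finset.single_le_sum (fun _ _ => Nat.zero_le _) (Finset.mem_univ i))
  have hp : (∑ l ∈ Λ, pureTensor n fun i => ψ i (l i)) ∈ V :=
    Submodule.sum_mem _ fun l hl => hVmem l hl _ fun i => hψW i (l i)
  have h1 := norm_pureTensor_sub_le n C₁ (decay k) ψ hψn _ Λ hΛ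
  rw [← hat] at h1
  have h2 : ‖atom n k κ - V.starProjection (atom n k κ)‖ ≤
      ‖atom n k κ - ∑ l ∈ Λ, pureTensor n fun i => ψ i (l i)‖ := by
    rw [Submodule.starProjection_minimal]
    exact ciInf_le ⟨0, by rintro _ ⟨_, rfl⟩; exact norm_nonneg _⟩ (⟨_, hp⟩ : V)
  refine (h2.trans h1).trans ?_
  rw [show C₁ ^ d * C₂ * √((∏ i, n i : ℕ) : ℝ) *
      s ^ (-((2 * k - 1) / (2 * ((harmonic d : ℚ) : ℝ)))) =
    C₁ ^ d * √((∏ i, n i : ℕ) : ℝ) *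
      (C₂ * s ^ (-((2 * k - 1) / (2 * ((harmonic d : ℚ) : ℝ))))) by ring]
  exact mul_le_mul_of_nonneg_left hΛ2 (by positivity)

end HyperbolicCross

/-! ### Oracle inequality for the margins. -/

section OracleInequality

variable {ι : Type*} [Fintype ι] [DecidableEq ι]

theorem norm_rowPart_le (n : ι → ℕ) (k : ℕ) (hk : 1 ≤ k) (w : Tensor n) :
    ‖rowPart n k w‖ ≤ ‖w‖ := by
  have h1 := inner_rowPart n k hk w _ (rowPart_mem n k w)
  rw [real_inner_self_eq_norm_sq] at h1
  have h2 := real_inner_le_norm w (rowPart n k w)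
  rcases (norm_nonneg (rowPart n k w)).eq_or_lt with h | h
  · rw [← h]
    exact norm_nonneg w
  · refine le_of_mul_le_mul_right ?_ h
    rw [← sq, ← h1]
    exact h2

theorem embed_rowPart (n : ι → ℕ) (k : ℕ) (hn : ∀ i, k ≤ n i) (M : Finset ι) (h : Label k M)
    (w : Tensor (subShape n M)) : embed n k M h (rowPart (subShape n M) k w) =
      ∑ a, totalDiff (subShape n M) k w a • atom n k (labelIdx n k hn M h a) := by
  rw [← embedLinear_apply, rowPart, map_sum]
  refine Finset.sum_congr rfl fun a _ => ?_
  rw [map_smul, embedLinear_apply, embed_atom n k hn]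

/-- The noise in a margin, tested against a tensor, expressed through the full noise tensor. -/
theorem inner_marginCoef (n : ι → ℕ) (k : ℕ) (hk : 1 ≤ k) (hn : ∀ i, k ≤ n i)
    (hn' : ∀ i, 0 < n i) (M : Finset ι) (h : Label k M) (w : Tensor (subShape n M))
    (e : Tensor n) :
    ((∏ i : {i // i ∉ M}, n i : ℕ) : ℝ) * inner ℝ w (marginCoef n k M h e) =
      inner ℝ (embed n k M h (rowPart (subShape n M) k w)) e := by
  rw [inner_rowPart (subShape n M) k hk w _ (marginCoef_mem_rowSpace n k hn hn' M h e),
    ← inner_embed n k hn, embed_marginCoef n k hn, margin,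
    ← Submodule.inner_starProjection_left_eq_right,
    Submodule.starProjection_eq_self_iff.mpr
      (embed_mem_marginSpace n k hn M h _ (rowPart_mem _ _ _))]

theorem prod_mem_mul_prod_notMem (n : ι → ℕ) (M : Finset ι) :
    (∏ i : {i // i ∈ M}, n i) * ∏ i : {i // i ∉ M}, n i = ∏ i, n i := by
  rw [← Fintype.prod_subtype_mul_prod_subtype (fun i => i ∈ M)]
  congr 1
  exact Finset.prod_congr (by ext; simp) fun _ _ => rfl

/-- The noise is split along `V`. The part in `V` is handled by `2xy ≤ x² + y²`. For the rest,
self-adjointness of the projection moves the residual onto the atoms, whose coefficients are the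
total differences of `w`; ℓ¹–ℓ^∞ duality then produces the variation. -/
theorem two_mul_inner_le (n : ι → ℕ) (k : ℕ) (hk : 1 ≤ k) (hn : ∀ i, k ≤ n i) (M : Finset ι)
    (h : Label k M) (w : Tensor (subShape n M)) (e : Tensor n) (V : Submodule ℝ (Tensor n))
    (lam : ℝ) (hV : ∀ a : Idx (subShape n M), (∀ i, k ≤ (a i : ℕ)) →
      |inner ℝ (atom n k (labelIdx n k hn M h a) -
        V.starProjection (atom n k (labelIdx n k hn M h a))) e| ≤ lam) :
    2 * inner ℝ (embed n k M h (rowPart (subShape n M) k w)) e ≤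
      ((∏ i : {i // i ∉ M}, n i : ℕ) : ℝ) * ‖w‖ ^ 2 + ‖V.starProjection e‖ ^ 2 +
        2 * (lam * vitaliTV (subShape n M) k w) := by
  set Z := embed n k M h (rowPart (subShape n M) k w) with hZ
  have h1 : inner ℝ Z e = inner ℝ Z (V.starProjection e) + inner ℝ Z (e - V.starProjection e) := by
    rw [← inner_add_right, add_sub_cancel]
  have h2 : 2 * inner ℝ Z (V.starProjection e) ≤
      ((∏ i : {i // i ∉ M}, n i : ℕ) : ℝ) * ‖w‖ ^ 2 + ‖V.starProjection e‖ ^ 2 := by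
    have h3 := real_inner_le_norm Z (V.starProjection e)
    have h4 : ‖Z‖ ^ 2 ≤ ((∏ i : {i // i ∉ M}, n i : ℕ) : ℝ) * ‖w‖ ^ 2 := by
      rw [hZ, norm_embed_sq n k hn]
      exact mul_le_mul_of_nonneg_left
        (pow_le_pow_left₀ (norm_nonneg _) (norm_rowPart_le _ k hk w) 2) (Nat.cast_nonneg _)
    linarith [two_mul_le_add_sq ‖Z‖ ‖V.starProjection e‖]
  have h5 : inner ℝ Z (e - V.starProjection e) ≤ lam * vitaliTV (subShape n M) k w := by
    rw [hZ, embed_rowPart n k hn, sum_inner, vitaliTV, Finset.mul_sum]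
    refine Finset.sum_le_sum fun a _ => ?_
    rw [real_inner_smul_left]
    by_cases ha : ∀ i, k ≤ (a i : ℕ)
    · have h6 : inner ℝ (atom n k (labelIdx n k hn M h a)) (e - V.starProjection e) =
          inner ℝ (atom n k (labelIdx n k hn M h a) -
            V.starProjection (atom n k (labelIdx n k hn M h a))) e := by
        rw [inner_sub_left, inner_sub_right, Submodule.inner_starProjection_left_eq_right]
      rw [h6]
      refine (le_abs_self _).trans ?_
      rw [abs_mul, mul_comm]
      exact mul_le_mul_of_nonneg_right (hV a ha) (abs_nonneg _)
    · rw [totalDiff_of_lt _ k w a ha]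
      simp
  linarith

/-- Oracle inequality for the estimator of one margin, on the event that the noise is controlled. -/
theorem margin_oracle (n : ι → ℕ) (k : ℕ) (hk : 1 ≤ k) (hn : ∀ i, k ≤ n i) (M : Finset ι)
    (h : Label k M) (f0 e : Tensor n) (ghat : Tensor (subShape n M)) (lam : ℝ) (hlam : 0 ≤ lam)
    (hmin : IsMinOn (tfObjective (subShape n M) k lam (marginCoef n k M h (f0 + e))) Set.univ ghat)
    (V : Submodule ℝ (Tensor n)) (hV : ∀ a : Idx (subShape n M), (∀ i, k ≤ (a i : ℕ)) →
      |inner ℝ (atom n k (labelIdx n k hn M h a) -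
        V.starProjection (atom n k (labelIdx n k hn M h a))) e| ≤ ((∏ i, n i : ℕ) : ℝ) * lam)
    (g : Tensor (subShape n M)) :
    ‖embed n k M h ghat - margin n k M h f0‖ ^ 2 ≤
      ((∏ i : {i // i ∉ M}, n i : ℕ) : ℝ) * ‖marginCoef n k M h f0 - g‖ ^ 2 +
        ‖V.starProjection e‖ ^ 2 +
        4 * (((∏ i, n i : ℕ) : ℝ) * lam * vitaliTV (subShape n M) k g) := by
  have hn' : ∀ i, 0 < n i := fun i => lt_of_lt_of_le hk (hn i)
  set b := marginCoef n k M h f0 with hb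
  set eb := marginCoef n k M h e with heb
  set Nc : ℝ := ((∏ i : {i // i ∉ M}, n i : ℕ) : ℝ) with hNc
  set NM : ℝ := ((∏ i : {i // i ∈ M}, n i : ℕ) : ℝ) with hNM
  have hN : ((∏ i, n i : ℕ) : ℝ) = NM * Nc := by
    rw [hNM, hNc, ← Nat.cast_mul, prod_mem_mul_prod_notMem]
  have hNc0 : 0 ≤ Nc := Nat.cast_nonneg _
  have hNM0 : 0 ≤ NM := Nat.cast_nonneg _
  rw [marginCoef_add, ← hb, ← heb] at hmin
  have h1 := isMinOn_tfObjective_variational (subShape n M) (fun i => hn' i) k lam hlam _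
    ghat g hmin
  rw [show (((∏ i : {i // i ∈ M}, subShape n M i : ℕ)) : ℝ) = NM from rfl] at h1
  have h2 := two_mul_inner_le n k hk hn M h (ghat - g) e V _ hV
  rw [← inner_marginCoef n k hk hn hn', ← heb, ← hNc, hN] at h2
  have h3 : ‖embed n k M h ghat - margin n k M h f0‖ ^ 2 = Nc * ‖ghat - b‖ ^ 2 := by
    rw [← embed_marginCoef n k hn, ← hb, ← embedLinear_apply, ← embedLinear_apply, ← map_sub,
      embedLinear_apply, norm_embed_sq n k hn]
  -- Basic identity: the term `-‖ghat - g‖²` will cancel the square coming from the noise in `V`,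
  -- which keeps the leading constant of the oracle inequality equal to one.
  have h4 : ‖ghat - b‖ ^ 2 = ‖b - g‖ ^ 2 - ‖ghat - g‖ ^ 2 + 2 * inner ℝ (ghat - g) eb +
      2 * inner ℝ (b + eb - ghat) (g - ghat) := by
    have e1 : b - g = (ghat - g) - (ghat - b) := by abel
    have e2 : inner ℝ (b + eb - ghat) (g - ghat) =
        inner ℝ (ghat - g) (ghat - b) - inner ℝ (ghat - g) eb := by
      rw [← inner_sub_right, real_inner_comm, ← neg_sub ghat g, inner_neg_left, ← inner_neg_right]
      congr 1
      abel
    rw [e1, norm_sub_sq_real (ghat - g), e2]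
    ring
  have h5 := vitaliTV_sub_le (subShape n M) k ghat g
  have h6 : Nc * (2 * inner ℝ (b + eb - ghat) (g - ghat)) ≤
      Nc * (2 * (NM * lam * (vitaliTV (subShape n M) k g - vitaliTV (subShape n M) k ghat))) :=
    mul_le_mul_of_nonneg_left (by linarith) hNc0
  -- The noise costs `TV ghat + TV g` and the penalty returns `TV g - TV ghat`: the variation of the
  -- estimator cancels, whence the factor 4.
  have h7 : NM * Nc * lam * vitaliTV (subShape n M) k (ghat - g) ≤ NM * Nc * lam *
      (vitaliTV (subShape n M) k ghat + vitaliTV (subShape n M) k g) :=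
    mul_le_mul_of_nonneg_left h5 (by positivity)
  rw [h3, h4, hN]
  linarith

theorem margin_oracle_approxError (n : ι → ℕ) (k : ℕ) (hk : 1 ≤ k) (hn : ∀ i, k ≤ n i)
    (M : Finset ι) (h : Label k M) (f0 e : Tensor n) (ghat : Tensor (subShape n M)) (lam c : ℝ)
    (hlam : 0 ≤ lam) (hc : 0 ≤ c)
    (hmin : IsMinOn (tfObjective (subShape n M) k lam (marginCoef n k M h (f0 + e))) Set.univ ghat)
    (V : Submodule ℝ (Tensor n)) (hV : ∀ a : Idx (subShape n M), (∀ i, k ≤ (a i : ℕ)) →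
      |inner ℝ (atom n k (labelIdx n k hn M h a) -
        V.starProjection (atom n k (labelIdx n k hn M h a))) e| ≤ ((∏ i, n i : ℕ) : ℝ) * lam) :
    ‖embed n k M h ghat - margin n k M h f0‖ ^ 2 / ((∏ i, n i : ℕ) : ℝ) ≤
      approxError n k M h c f0 + ‖V.starProjection e‖ ^ 2 / ((∏ i, n i : ℕ) : ℝ) +
        4 * (lam * c) := by
  have hn' : ∀ i, 0 < n i := fun i => lt_of_lt_of_le hk (hn i)
  have hne : Nonempty {g : Tensor (subShape n M) // vitaliTV (subShape n M) k g ≤ c} :=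
    ⟨⟨0, by rw [vitaliTV_zero]; exact hc⟩⟩
  have hN : ((∏ i, n i : ℕ) : ℝ) = ((∏ i : {i // i ∈ M}, n i : ℕ) : ℝ) *
      ((∏ i : {i // i ∉ M}, n i : ℕ) : ℝ) := by
    rw [← Nat.cast_mul, prod_mem_mul_prod_notMem]
  have hN0 : (0 : ℝ) < ((∏ i, n i : ℕ) : ℝ) := by
    exact_mod_cast Finset.prod_pos fun i _ => hn' i
  have hM0 : (0 : ℝ) < ((∏ i : {i // i ∈ M}, n i : ℕ) : ℝ) := by
    exact_mod_cast Finset.prod_pos fun (i : {i // i ∈ M}) _ => hn' i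
  suffices hs : ‖embed n k M h ghat - margin n k M h f0‖ ^ 2 / ((∏ i, n i : ℕ) : ℝ) -
      ‖V.starProjection e‖ ^ 2 / ((∏ i, n i : ℕ) : ℝ) - 4 * (lam * c) ≤
        approxError n k M h c f0 by linarith
  refine le_ciInf fun g => ?_
  have h1 := margin_oracle n k hk hn M h f0 e ghat lam hlam hmin V hV g.1
  have h2 : ((∏ i, n i : ℕ) : ℝ) * lam * vitaliTV (subShape n M) k g.1 ≤
      ((∏ i, n i : ℕ) : ℝ) * lam * c := mul_le_mul_of_nonneg_left g.2 (by positivity)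
  have h3 : ‖marginCoef n k M h f0 - g.1‖ ^ 2 / ((∏ i : {i // i ∈ M}, n i : ℕ) : ℝ) =
      ((∏ i : {i // i ∉ M}, n i : ℕ) : ℝ) * ‖marginCoef n k M h f0 - g.1‖ ^ 2 /
        ((∏ i, n i : ℕ) : ℝ) := by
    have : (0 : ℝ) < ((∏ i : {i // i ∉ M}, n i : ℕ) : ℝ) := by
      exact_mod_cast Finset.prod_pos fun (i : {i // i ∉ M}) _ => hn' i
    rw [hN]
    field_simp
  rw [h3, ← sub_div, sub_le_iff_le_add, div_add' _ _ _ hN0.ne', div_le_div_iff_of_pos_right hN0]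
  linarith

/-- Tensors with no indices form a line. Least squares on such a margin costs only a bounded
dimension. -/
theorem finrank_marginSpace_empty_le (n : ι → ℕ) (k : ℕ) (hn : ∀ i, k ≤ n i) (h : Label k ∅) :
    Module.finrank ℝ (marginSpace n k ∅ h) ≤ 1 := by
  rw [marginSpace_eq_map n k hn]
  refine (Submodule.finrank_map_le _ _).trans ((Submodule.finrank_le _).trans ?_)
  rw [finrank_euclideanSpace, Fintype.card_pi]
  simp

theorem embed_marginCoef_sub (n : ι → ℕ) (k : ℕ) (hn : ∀ i, k ≤ n i) (M : Finset ι)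
    (h : Label k M) (f0 e : Tensor n) :
    embed n k M h (marginCoef n k M h (f0 + e)) - margin n k M h f0 =
      (marginSpace n k M h).starProjection e := by
  rw [embed_marginCoef n k hn, margin, margin, map_add, add_sub_cancel_left]

/-- The squared error of the whole estimator is the sum of the squared errors of the margins. -/
theorem norm_estimator_sub_sq (n : ι → ℕ) (k : ℕ) (hk : 1 ≤ k) (hn : ∀ i, k ≤ n i)
    (lam : ∀ M : Finset ι, Label k M → ℝ) (f0 e : Tensor n)
    (g : ∀ M : Finset ι, Label k M → Tensor (subShape n M))
    (hg0 : ∀ h, g ∅ h = marginCoef n k ∅ h (f0 + e))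
    (hg : ∀ M : Finset ι, M.Nonempty → ∀ h : Label k M,
      IsMinOn (tfObjective (subShape n M) k (lam M h) (marginCoef n k M h (f0 + e)))
        Set.univ (g M h)) :
    ‖∑ M : Finset ι, ∑ h : Label k M, embed n k M h (g M h) - f0‖ ^ 2 =
      ∑ M : Finset ι, ∑ h : Label k M, ‖embed n k M h (g M h) - margin n k M h f0‖ ^ 2 := by
  have hn' : ∀ i, 0 < n i := fun i => lt_of_lt_of_le hk (hn i)
  conv_lhs => rw [← sum_margin n k hk hn f0]
  rw [← Finset.sum_sub_distrib]
  simp only [← Finset.sum_sub_distrib]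
  refine norm_sum_marginSpace_sq n k _ fun M h => Submodule.sub_mem _ ?_
    (Submodule.starProjection_apply_mem _ _)
  refine embed_mem_marginSpace n k hn M h _ ?_
  -- Orthogonality of the errors requires each estimated margin to stay in its own space: for
  -- penalised margins this is `mem_rowSpace_of_isMinOn`.
  rcases M.eq_empty_or_nonempty with rfl | hM
  · rw [hg0]
    exact marginCoef_mem_rowSpace n k hn hn' _ h _
  · exact mem_rowSpace_of_isMinOn (subShape n M) (fun i => hn' i) k hk _ _ _
      (marginCoef_mem_rowSpace n k hn hn' M h _) (hg M hM h)

end OracleInequality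

/-! ### Balancing dimension against approximation error. -/

section Rate

theorem rate_exponent_pos (d k : ℕ) (hd : 1 ≤ d) (hk : 1 ≤ k) :
    0 < ((harmonic d : ℚ) : ℝ) / (2 * ((harmonic d : ℚ) : ℝ) + 2 * k - 1) := by
  have hH := harmonic_one_le d hd
  have hk' : (1 : ℝ) ≤ k := by exact_mod_cast hk
  exact div_pos (by linarith) (by linarith)

theorem mul_rate (d k N : ℕ) (hd : 1 ≤ d) (hk : 1 ≤ k) (hN : 2 ≤ N) :
    (N : ℝ) * rate d k N = ((N : ℝ) * Real.log N) ^
      (((harmonic d : ℚ) : ℝ) / (2 * ((harmonic d : ℚ) : ℝ) + 2 * k - 1)) := by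
  have hH := harmonic_one_le d hd
  have hk' : (1 : ℝ) ≤ k := by exact_mod_cast hk
  have hN' : (1 : ℝ) < N := by exact_mod_cast (show 1 < N by omega)
  have hN0 : (0 : ℝ) < N := by linarith
  rw [rate, Real.mul_rpow hN0.le (Real.log_pos hN').le, ← mul_assoc]
  congr 1
  conv_lhs => rw [← Real.rpow_one (N : ℝ), ← Real.rpow_mul hN0.le, one_mul, ← Real.rpow_add hN0]
  congr 1
  have : 2 * ((harmonic d : ℚ) : ℝ) + 2 * k - 1 ≠ 0 := by linarith
  rw [eq_div_iff this, add_mul, div_mul_cancel₀ _ this]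
  ring

theorem rate_pos (d k N : ℕ) (hN : 2 ≤ N) : 0 < rate d k N := by
  have hN' : (1 : ℝ) < N := by exact_mod_cast (show 1 < N by omega)
  exact mul_pos (Real.rpow_pos_of_pos (by linarith) _)
    (Real.rpow_pos_of_pos (Real.log_pos hN') _)

theorem one_le_mul_log (N : ℕ) (hN : 2 ≤ N) : 1 ≤ (N : ℝ) * Real.log N := by
  have hN' : (2 : ℝ) ≤ N := by exact_mod_cast hN
  have h1 := Real.log_le_log two_pos hN'
  have h2 := Real.log_two_gt_d9
  nlinarith

theorem one_le_mul_rate (d k N : ℕ) (hd : 1 ≤ d) (hk : 1 ≤ k) (hN : 2 ≤ N) :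
    1 ≤ (N : ℝ) * rate d k N := by
  rw [mul_rate d k N hd hk hN]
  exact Real.one_le_rpow (one_le_mul_log N hN) (rate_exponent_pos d k hd hk).le

/-- The balance that determines the rate: s = n r_n is the fixed point of approximation error times
noise level. In exponents, p (1 + (2k-1)/(2H)) = 1/2 for p = H/(2H+2k-1). -/
theorem sqrt_mul_log_mul_rpow (d k N : ℕ) (hd : 1 ≤ d) (hk : 1 ≤ k) (hN : 2 ≤ N) :
    √((N : ℝ) * Real.log N) *
      ((N : ℝ) * rate d k N) ^ (-((2 * k - 1) / (2 * ((harmonic d : ℚ) : ℝ)))) =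
      (N : ℝ) * rate d k N := by
  have hH := harmonic_one_le d hd
  have hk' : (1 : ℝ) ≤ k := by exact_mod_cast hk
  have h1 := one_le_mul_log N hN
  have h0 : 0 < (N : ℝ) * Real.log N := by linarith
  rw [mul_rate d k N hd hk hN, Real.sqrt_eq_rpow, ← Real.rpow_mul h0.le, ← Real.rpow_add h0]
  congr 1
  have : 2 * ((harmonic d : ℚ) : ℝ) + 2 * k - 1 ≠ 0 := by linarith
  have : ((harmonic d : ℚ) : ℝ) ≠ 0 := by linarith
  generalize hD : 2 * ((harmonic d : ℚ) : ℝ) + 2 * k - 1 = D at *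
  rw [show (2 * k - 1 : ℝ) = D - 2 * ((harmonic d : ℚ) : ℝ) by linarith]
  field_simp
  ring

/-- Absorbs the logarithm that the union bound adds to the chi-square terms: `log N ≤ N^p / p`. -/
theorem exists_log_le_mul_rate (d k : ℕ) (hd : 1 ≤ d) (hk : 1 ≤ k) : ∃ C : ℝ, 0 < C ∧
    ∀ N : ℕ, 2 ≤ N → Real.log N ≤ C * ((N : ℝ) * rate d k N) := by
  have hp := rate_exponent_pos d k hd hk
  set p := ((harmonic d : ℚ) : ℝ) / (2 * ((harmonic d : ℚ) : ℝ) + 2 * k - 1) with hpdef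
  have hl2 : 0 < Real.log 2 := Real.log_pos one_lt_two
  refine ⟨p⁻¹ * (Real.log 2 ^ p)⁻¹, by positivity, fun N hN => ?_⟩
  have hN' : (2 : ℝ) ≤ N := by exact_mod_cast hN
  have h1 := Real.log_le_rpow_div (by linarith : (0 : ℝ) ≤ N) hp
  have h2 : Real.log 2 ^ p ≤ Real.log N ^ p :=
    Real.rpow_le_rpow hl2.le (Real.log_le_log two_pos hN') hp.le
  have h3 : 0 < Real.log 2 ^ p := Real.rpow_pos_of_pos hl2 _
  rw [mul_rate d k N hd hk hN, ← hpdef, Real.mul_rpow (by linarith) (hl2.le.trans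
    (Real.log_le_log two_pos hN'))]
  refine h1.trans ?_
  rw [show p⁻¹ * (Real.log 2 ^ p)⁻¹ * ((N : ℝ) ^ p * Real.log N ^ p) =
    (N : ℝ) ^ p / p * (Real.log N ^ p / Real.log 2 ^ p) by field_simp]
  exact le_mul_of_one_le_right (by positivity) ((one_le_div h3).mpr h2)

theorem exists_approx_space_rate (d k : ℕ) (hd : 1 ≤ d) (hk : 1 ≤ k) (b : ℝ) (hb : 0 < b) :
    ∃ C : ℝ, 0 < C ∧
    ∀ (n : Fin d → ℕ) (hn : ∀ i, k ≤ n i), 2 ≤ ∏ i, n i → ∀ (M : Finset (Fin d)) (h : Label k M),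
    ∃ V : Submodule ℝ (Tensor n),
      (Module.finrank ℝ V : ℝ) ≤ C * (((∏ i, n i : ℕ) : ℝ) * rate d k (∏ i, n i)) ∧
      (M = ∅ → V = marginSpace n k M h) ∧
      (M.Nonempty → ∀ a : Idx (subShape n M), (∀ i, k ≤ (a i : ℕ)) →
        √(Real.log (∏ i, n i : ℕ)) * ‖atom n k (labelIdx n k hn M h a) -
          V.starProjection (atom n k (labelIdx n k hn M h a))‖ ≤
        b * (((∏ i, n i : ℕ) : ℝ) * rate d k (∏ i, n i))) := by
  obtain ⟨C, hC, hV⟩ := exists_approx_space d k hd hk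
  have hH := harmonic_one_le d hd
  have hk' : (1 : ℝ) ≤ k := by exact_mod_cast hk
  set q : ℝ := (2 * k - 1) / (2 * ((harmonic d : ℚ) : ℝ)) with hq
  have hq0 : 0 < q := div_pos (by linarith) (by linarith)
  -- Enlarging the dimension by the constant `B` pushes the residuals below an arbitrary multiple
  -- `b`, so that any lower constant `a > 0` for the tuning parameters suffices.
  set B : ℝ := max 1 ((C / b) ^ (1 / q)) with hB
  have hB1 : 1 ≤ B := le_max_left _ _
  have hBq : C * B ^ (-q) ≤ b := by
    have h1 : C / b ≤ B ^ q := by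
      have h2 : (C / b) ^ (1 / q) ≤ B := le_max_right _ _
      have h3 := Real.rpow_le_rpow (by positivity) h2 hq0.le
      rwa [← Real.rpow_mul (by positivity), one_div_mul_cancel hq0.ne', Real.rpow_one] at h3
    have h4 : 0 < B ^ q := Real.rpow_pos_of_pos (by linarith) _
    rw [Real.rpow_neg (by linarith), ← div_eq_mul_inv, div_le_iff₀ h4]
    rwa [div_le_iff₀ hb, mul_comm] at h1
  refine ⟨C * B + 1, by positivity, fun n hn hN M h => ?_⟩
  set N := ∏ i, n i with hNdef
  have hs1 := one_le_mul_rate d k N hd hk hN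
  set s := (N : ℝ) * rate d k N with hs
  rcases M.eq_empty_or_nonempty with rfl | hM
  · refine ⟨marginSpace n k ∅ h, ?_, fun _ => rfl, fun h0 => absurd h0 (by simp)⟩
    have h1 : (Module.finrank ℝ (marginSpace n k ∅ h) : ℝ) ≤ 1 := by
      exact_mod_cast finrank_marginSpace_empty_le n k hn h
    have h2 : 0 ≤ C * B * s := by positivity
    linarith
  · obtain ⟨V, hV1, hV2⟩ := hV n hn M h (B * s) (one_le_mul_of_one_le_of_one_le hB1 hs1)
    refine ⟨V, by linarith, fun h0 => absurd h0 hM.ne_empty, fun _ a ha => ?_⟩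
    have h1 := sqrt_mul_log_mul_rpow d k N hd hk hN
    rw [← hs, ← hq, Real.sqrt_mul (Nat.cast_nonneg N)] at h1
    have h2 := mul_le_mul_of_nonneg_left (hV2 a ha) (Real.sqrt_nonneg (Real.log N))
    refine h2.trans ?_
    rw [Real.mul_rpow (by linarith) (by linarith)]
    calc √(Real.log N) * (C * √(N : ℝ) * (B ^ (-q) * s ^ (-q)))
        = C * B ^ (-q) * (√(N : ℝ) * √(Real.log N) * s ^ (-q)) := by ring
      _ = C * B ^ (-q) * s := by rw [h1]
      _ ≤ b * s := mul_le_mul_of_nonneg_right hBq (by linarith)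

end Rate

end TrendFiltering

end

/-! ### The noise event and the conclusion. -/

namespace TrendFiltering

theorem card_subShape_le {d : ℕ} (n : Fin d → ℕ) (hn' : ∀ i, 0 < n i) (M : Finset (Fin d)) :
    Fintype.card (Idx (subShape n M)) ≤ ∏ i, n i := by
  rw [Fintype.card_pi]
  simp only [Fintype.card_fin]
  rw [← prod_mem_mul_prod_notMem n M]
  exact Nat.le_mul_of_pos_right _ (Finset.prod_pos fun (i : {i // i ∉ M}) _ => hn' i)

/-- The noise is controlled in all margins simultaneously with high probability. -/
theorem noise_control {d k : ℕ} (n : Fin d → ℕ) (hn : ∀ i, k ≤ n i) (hn' : ∀ i, 0 < n i)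
    {σ : ℝ≥0} (hσ : 0 < σ)
    (V : ∀ M : Finset (Fin d), Label k M → Submodule ℝ (Tensor n)) (γ : ℝ) (hγ : 0 < γ)
    (hV : ∀ M : Finset (Fin d), M.Nonempty → ∀ h : Label k M, ∀ a : Idx (subShape n M),
      (∀ i, k ≤ (a i : ℕ)) → √(Real.log (∏ i, n i : ℕ)) *
        ‖atom n k (labelIdx n k hn M h a) -
          (V M h).starProjection (atom n k (labelIdx n k hn M h a))‖ ≤ γ)
    (hN : 2 ≤ ∏ i, n i)
    {Ω : Type*} [MeasurableSpace Ω] (P : Measure Ω) [IsProbabilityMeasure P]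
    (ε : Idx n → Ω → ℝ) (hind : iIndepFun ε P)
    (hlaw : ∀ j, HasLaw (ε j) (gaussianReal 0 (σ ^ 2)) P) :
    1 - 3 * Fintype.card (Σ M : Finset (Fin d), Label k M) / ((∏ i, n i : ℕ) : ℝ) ≤
      P.real {ω | (∀ M : Finset (Fin d), M.Nonempty → ∀ h : Label k M, ∀ a : Idx (subShape n M),
          (∀ i, k ≤ (a i : ℕ)) →
          |inner ℝ (atom n k (labelIdx n k hn M h a) -
            (V M h).starProjection (atom n k (labelIdx n k hn M h a)))
            (WithLp.toLp 2 fun j => ε j ω)| ≤ 2 * σ * γ) ∧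
        ∀ M h, ‖(V M h).starProjection (WithLp.toLp 2 fun j => ε j ω)‖ ^ 2 ≤
          σ ^ 2 * (2 * Module.finrank ℝ (V M h) + 4 * Real.log (∏ i, n i : ℕ))} := by
  classical
  set N := ∏ i, n i with hNdef
  have hN1 : (1 : ℝ) < N := by exact_mod_cast (show 1 < N by omega)
  have hlog : 0 < Real.log N := Real.log_pos hN1
  set t : ℝ := √(Real.log N) with ht
  have ht0 : 0 < t := Real.sqrt_pos.mpr hlog
  have ht2 : t ^ 2 = Real.log N := Real.sq_sqrt hlog.le
  let L := Σ M : Finset (Fin d), Label k M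
  let r : (Σ p : L, Idx (subShape n p.1)) → Tensor n := fun q =>
    atom n k (labelIdx n k hn q.1.1 q.1.2 q.2) -
      (V q.1.1 q.1.2).starProjection (atom n k (labelIdx n k hn q.1.1 q.1.2 q.2))
  -- Residuals normalised to norm at most one; irrelevant indices receive the zero vector.
  let u : (Σ p : L, Idx (subShape n p.1)) → Tensor n := fun q =>
    if q.1.1.Nonempty ∧ ∀ i, k ≤ (q.2 i : ℕ) then (t / γ) • r q else 0
  have hu : ∀ q, ‖u q‖ ≤ 1 := by
    intro q
    simp only [u]
    split_ifs with hq
    · rw [norm_smul, Real.norm_eq_abs, abs_of_pos (div_pos ht0 hγ), div_mul_eq_mul_div,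
        div_le_one hγ]
      exact hV q.1.1 hq.1 q.1.2 q.2 hq.2
    · rw [norm_zero]
      exact zero_le_one
  -- At level `2 √(log N)` each functional fails with probability at most `2 N⁻²`, enough for at
  -- most `N` functionals per margin; each projection fails with probability at most `N⁻¹`. This
  -- gives the 3 in the bound.
  have hev := iid_gaussian_event hσ ε hind hlaw u hu (fun p : L => V p.1 p.2) (2 * t) (Real.log N)
    (by positivity)
  refine le_trans ?_ (hev.trans (measureReal_mono (fun ω hω => ?_) (measure_ne_top _ _)))
  · have hexp1 : Real.exp (-(2 * t) ^ 2 / 2) = ((N : ℝ) ^ 2)⁻¹ := by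
      rw [mul_pow, ht2, show -(2 ^ 2 * Real.log N) / 2 = -(Real.log N + Real.log N) by ring,
        Real.exp_neg, Real.exp_add, Real.exp_log (by linarith), sq]
    have hexp2 : Real.exp (-Real.log N) = (N : ℝ)⁻¹ := by
      rw [Real.exp_neg, Real.exp_log (by linarith)]
    have hcard : (Fintype.card (Σ p : L, Idx (subShape n p.1)) : ℝ) ≤ Fintype.card L * N := by
      have h1 : Fintype.card (Σ p : L, Idx (subShape n p.1)) ≤ Fintype.card L * N := by
        rw [Fintype.card_sigma]
        refine (Finset.sum_le_sum fun p _ => card_subShape_le n hn' p.1).trans_eq ?_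
        rw [Finset.sum_const, Finset.card_univ, smul_eq_mul]
      exact_mod_cast h1
    rw [hexp1, hexp2]
    have h2 : (Fintype.card (Σ p : L, Idx (subShape n p.1)) : ℝ) * (2 * ((N : ℝ) ^ 2)⁻¹) ≤
        Fintype.card L * N * (2 * ((N : ℝ) ^ 2)⁻¹) :=
      mul_le_mul_of_nonneg_right hcard (by positivity)
    have h3 : (Fintype.card L : ℝ) * N * (2 * ((N : ℝ) ^ 2)⁻¹) = 2 * (Fintype.card L / N) := by
      have : (N : ℝ) ≠ 0 := by linarith
      field_simp
    rw [h3] at h2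
    have h4 : (Fintype.card L : ℝ) * (N : ℝ)⁻¹ = Fintype.card L / N := (div_eq_mul_inv _ _).symm
    rw [h4, mul_div_assoc]
    change 1 - 3 * ((Fintype.card L : ℝ) / N) ≤ _
    linarith
  · refine ⟨fun M hM h a ha => ?_, fun M h => hω.2 ⟨M, h⟩⟩
    have h1 := hω.1 ⟨⟨M, h⟩, a⟩
    simp only [u] at h1
    rw [if_pos ⟨hM, ha⟩, real_inner_smul_left, abs_mul, abs_of_pos (div_pos ht0 hγ),
      div_mul_eq_mul_div, div_le_iff₀ hγ] at h1
    refine le_of_mul_le_mul_left ?_ ht0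
    refine h1.trans_eq ?_
    ring

end TrendFiltering

theorem theorem6p2 (d k : ℕ) (hd : 1 ≤ d) (hk : 1 ≤ k) (σ : ℝ≥0) (hσ : 0 < σ)
    (K a A cmax : ℝ) (ha : 0 < a) :
    ∃ C₁ C₂ : ℝ, 0 < C₁ ∧ 0 < C₂ ∧
      ∀ n : Fin d → ℕ, (∀ i, k + 1 ≤ n i) → (∀ i j, (n i : ℝ) ≤ K * n j) →
      ∀ lam : ∀ M : Finset (Fin d), Label k M → ℝ,
        (∀ M : Finset (Fin d), M.Nonempty → ∀ h : Label k M,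
          a * rate d k (∏ i, n i) ≤ lam M h ∧ lam M h ≤ A * rate d k (∏ i, n i)) →
      ∀ c : ∀ M : Finset (Fin d), Label k M → ℝ,
        (∀ (M : Finset (Fin d)) (h : Label k M), 0 < c M h ∧ c M h ≤ cmax) →
      ∀ (Ω : Type*) [MeasurableSpace Ω] (P : Measure Ω) [IsProbabilityMeasure P]
        (f0 : Tensor n) (ε : Idx n → Ω → ℝ) (fhat : Ω → Tensor n),
        iIndepFun ε P → (∀ j, HasLaw (ε j) (gaussianReal 0 (σ ^ 2)) P) →
        (∀ ω, IsWholeEstimator n k lam (f0 + WithLp.toLp 2 fun j => ε j ω) (fhat ω)) →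
        1 - C₁ / ((∏ i, n i : ℕ) : ℝ) ≤
          P.real {ω | ‖fhat ω - f0‖ ^ 2 / ((∏ i, n i : ℕ) : ℝ) ≤
            (∑ M ∈ Finset.univ.filter (fun M : Finset (Fin d) => M.Nonempty),
              ∑ h : Label k M, approxError n k M h (c M h) f0) +
            C₂ * rate d k (∏ i, n i)} := by
  have hσ' : (0 : ℝ) < σ := hσ
  -- With `b = a / (2σ)`, the noise bound `2 σ b N r_n` equals `a N r_n`, which is at most `N * lam
  -- M h`.
  obtain ⟨C, hC, hspace⟩ := exists_approx_space_rate d k hd hk (a / (2 * σ)) (by positivity)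
  obtain ⟨C', hC', hlogle⟩ := exists_log_le_mul_rate d k hd hk
  set Lb : ℝ := (Fintype.card (Σ M : Finset (Fin d), Label k M) : ℝ) with hLb
  have hLb0 : 0 ≤ Lb := Nat.cast_nonneg _
  -- Cost of one margin in units of the rate: the chi-square bound, with dimension at most `C s` and
  -- logarithm at most `C' s`, plus the penalty `4 lam c`. Absolute values avoid sign conditions on
  -- `A` and `cmax`.
  set D : ℝ := σ ^ 2 * (2 * C + 4 * C') + 4 * (|A| * |cmax|) with hD
  have hD0 : 0 ≤ D := by positivity
  refine ⟨3 * Lb + 1, Lb * D + 1, by positivity, by positivity, ?_⟩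
  intro n hn1 _ lam hlam c hc Ω _ P _ f0 ε fhat hind hlaw hest
  have hn : ∀ i, k ≤ n i := fun i => (Nat.le_succ k).trans (hn1 i)
  have hn' : ∀ i, 0 < n i := fun i => lt_of_lt_of_le k.succ_pos (hn1 i)
  have hN2 : 2 ≤ ∏ i, n i := by
    have h1 : n ⟨0, hd⟩ ≤ ∏ i, n i :=
      Finset.single_le_prod' (fun i _ => hn' i) (Finset.mem_univ _)
    have := hn1 ⟨0, hd⟩
    omega
  choose V hVdim hVempty hVapprox using hspace n hn hN2
  have hrate := rate_pos d k (∏ i, n i) hN2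
  set N := ∏ i, n i with hN
  set ρ := rate d k N with hρ
  have hN0 : (0 : ℝ) < N := by exact_mod_cast (show 0 < N by omega)
  have hnoise := noise_control n hn hn' hσ V (a / (2 * σ) * ((N : ℝ) * ρ)) (by positivity)
    (fun M hM h => hVapprox M h hM) hN2 P ε hind hlaw
  rw [← hN, ← hLb] at hnoise
  refine le_trans ?_ (hnoise.trans (measureReal_mono (fun ω hω => ?_) (measure_ne_top _ _)))
  · have : 3 * Lb / N ≤ (3 * Lb + 1) / N := div_le_div_of_nonneg_right (by linarith) hN0.le
    linarith
  obtain ⟨h1, h2⟩ := hω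
  set e : Tensor n := WithLp.toLp 2 fun j => ε j ω with he
  obtain ⟨g, hg0, hg, hfhat⟩ := hest ω
  rw [← he] at hg0 hg
  have hproj : ∀ M h, ‖(V M h).starProjection e‖ ^ 2 / N ≤ σ ^ 2 * (2 * C + 4 * C') * ρ := by
    intro M h
    rw [div_le_iff₀ hN0]
    refine (h2 M h).trans ?_
    have h3 := hVdim M h
    have h4 := hlogle N hN2
    rw [mul_assoc, mul_assoc]
    refine mul_le_mul_of_nonneg_left ?_ (by positivity)
    linarith
  have hterm : ∀ M h, ‖embed n k M h (g M h) - margin n k M h f0‖ ^ 2 / N ≤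
      (if M.Nonempty then approxError n k M h (c M h) f0 else 0) + D * ρ := by
    intro M h
    have hA : 0 ≤ |A| * |cmax| * ρ := by positivity
    rcases M.eq_empty_or_nonempty with rfl | hM
    · rw [if_neg Finset.not_nonempty_empty, hg0, embed_marginCoef_sub n k hn,
        ← hVempty ∅ h rfl]
      have := hproj ∅ h
      rw [hD]
      linarith
    · rw [if_pos hM]
      obtain ⟨hl1, hl2⟩ := hlam M hM h
      have hl0 : 0 ≤ lam M h := le_trans (by positivity) hl1
      have hc0 := hc M h
      have h3 := margin_oracle_approxError n k hk hn M h f0 e (g M h) (lam M h) (c M h) hl0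
        hc0.1.le (hg M hM h) (V M h) fun b hb => (h1 M hM h b hb).trans (by
          rw [← hN]
          calc 2 * (σ : ℝ) * (a / (2 * σ) * ((N : ℝ) * ρ)) = N * (a * ρ) := by field_simp
            _ ≤ N * lam M h := mul_le_mul_of_nonneg_left hl1 hN0.le)
      rw [← hN] at h3
      have h4 := hproj M h
      have h5 : lam M h * c M h ≤ |A| * |cmax| * ρ := by
        calc lam M h * c M h ≤ (|A| * ρ) * |cmax| := by
              refine mul_le_mul (hl2.trans ?_) (hc0.2.trans (le_abs_self _)) hc0.1.le
                (by positivity)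
              exact mul_le_mul_of_nonneg_right (le_abs_self A) hrate.le
          _ = _ := by ring
      rw [hD]
      linarith
  rw [Set.mem_ofPred_eq, hfhat, norm_estimator_sub_sq n k hk hn lam f0 e g hg0 hg, Finset.sum_div]
  simp only [Finset.sum_div]
  refine (Finset.sum_le_sum fun M _ => Finset.sum_le_sum fun h _ => hterm M h).trans ?_
  simp only [Finset.sum_add_distrib]
  refine add_le_add (le_of_eq ?_) ?_
  · rw [Finset.sum_filter]
    refine Finset.sum_congr rfl fun M _ => ?_
    split_ifs <;> simp
  · rw [← Fintype.sum_sigma' (fun (M : Finset (Fin d)) (_ : Label k M) => D * ρ), Finset.sum_const,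
      Finset.card_univ, nsmul_eq_mul, ← hLb]
    linarith
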